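/- Work on the torus $\mathbb T^2=[0,2\pi)^2$ with periodic boundary conditions. Let $U_0>0$, let $m,k$ be integers with $1\le k<m$, let $\mathbf u_0(x,y)=(U_0\sin(my),0)$, and put $$\gamma_u=U_0k\sqrt{\tfrac12\,\tfrac{m^2-k^2}{m^2+k^2}} .$$ Let $\tilde{\mathbf v}=(-\partial_y\psi,\partial_x\psi)$ and $\tilde p$ be a growing normal mode of the Euler equations linearized about $\mathbf u_0$: $\psi=\mathrm{Re}\,(e^{\gamma t+ikx}\chi(y))$ and $\tilde p=\mathrm{Re}\,(e^{\gamma t+ikx}\varpi(y))$ with $\gamma>0$ real, $\chi,\varpi$ smooth, complex-valued and $2\pi$-periodic, and $$\partial_t\tilde{\mathbf v}=-(\mathbf u_0\cdot\nabla)\tilde{\mathbf v}-(\tilde{\mathbf v}\cdot\nabla)\mathbf u_0-\nabla\tilde p,\qquad \nabla\cdot\tilde{\mathbf v}=0 .$$ Assume that $\chi$ is $2\pi/m$-periodic (only the Fourier modes $e^{ijy}$ with $m\mid j$ occur) or that $\gamma\le\gamma_u$. For $0<\epsilon<1$ let $\tilde{\mathbf u}=\mathbf u_0+\epsilon\tilde{\mathbf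 v}$ be the linearized solution. Write $\omega_{\mathbf f}=\partial_xf_y-\partial_yf_x$ for the vorticity of a field $\mathbf f$. Call positive constants $\alpha,\beta,b_1,b_2$ admissible if $\alpha\beta>2\gamma_u$, if for all $\epsilon\in(0,1)$ and all $t\in[0,\gamma_u^{-1}\log(1/\epsilon)]$ $$\|\tilde{\mathbf u}(t)\|_{L^\infty}\le\alpha^2,\qquad \|\nabla\omega_{\tilde{\mathbf u}}(t)\|_{L^\infty}\le\beta^2,$$ and if for all $t\ge0$ $$\|(\tilde{\mathbf v}\cdot\nabla)\tilde{\mathbf v}\|_{L^2}\le b_1e^{2\gamma_ut},\qquad \|\tilde{\mathbf v}\cdot\nabla\omega_{\tilde{\mathbf v}}\|_{L^2}\le b_2e^{2\gamma_ut}.$$ Then admissible constants exist. Moreover, for all admissible $\alpha,\beta,b_1,b_2$, with $$\kappa=\frac1{\alpha\beta-2\gamma_u}\Big(b_1+\frac{\alpha b_2}{2\beta}\Big),$$ the following holds for every $0<\epsilon<1$. Let $(\mathbf u,P)$ be a classical ($C^2$, spatially periodic) solution on $[0,T]$ of the incompressible Euler equations $\partial_t\mathbf u+(\mathbf u\cdot\nabla)\mathbf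 u=-\nabla P$, $\nabla\cdot\mathbf u=0$, with $\mathbf u(0)=\tilde{\mathbf u}(0)$, and let $\boldsymbol\eta=\mathbf u-\tilde{\mathbf u}$. Then for all $t\in[0,T]$ with $t\le\gamma_u^{-1}\log(1/\epsilon)$, $$\|\boldsymbol\eta(t)\|_{L^2}\le\epsilon^2\kappa\,(e^{\alpha\beta t}-1).$$ -/

import Mathlib

open Set Real
open scoped ContDiff

noncomputable section

namespace EulerTorus

/-- A planar vector field. A field on the torus `[0, 2π)²` with periodic boundary conditions is a
`2π`-periodic field on the plane, see `PeriodicField`. -/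
abbrev VField : Type := ℝ × ℝ → ℝ × ℝ

/-- `2π`-periodicity in both coordinates. -/
def PeriodicField {F : Type*} (f : ℝ × ℝ → F) : Prop :=
  ∀ x y : ℝ, f (x + 2 * π, y) = f (x, y) ∧ f (x, y + 2 * π) = f (x, y)

/-- Euclidean length of a planar vector (the norm of `ℝ × ℝ` is the sup norm). -/
def vecLength (w : ℝ × ℝ) : ℝ := √(w.1 ^ 2 + w.2 ^ 2)

/-- The `L²` norm of a real function over the torus `[0, 2π)²`. -/
def scalarL2 (g : ℝ × ℝ → ℝ) : ℝ :=
  √(∫ z in Ico 0 (2 * π) ×ˢ Ico 0 (2 * π), g z ^ 2)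

/-- The `L²` norm of a vector field over the torus `[0, 2π)²`. -/
def fieldL2 (f : VField) : ℝ := scalarL2 (fun z => vecLength (f z))

/-- The partial derivative `∂f/∂x`. -/
def partialX {F : Type*} [NormedAddCommGroup F] [NormedSpace ℝ F] (f : ℝ × ℝ → F) (z : ℝ × ℝ) : F :=
  fderiv ℝ f z (1, 0)

/-- The partial derivative `∂f/∂y`. -/
def partialY {F : Type*} [NormedAddCommGroup F] [NormedSpace ℝ F] (f : ℝ × ℝ → F) (z : ℝ × ℝ) : F :=
  fderiv ℝ f z (0, 1)

/-- The gradient of a scalar function. -/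
def grad (p : ℝ × ℝ → ℝ) : VField := fun z => (partialX p z, partialY p z)

/-- The divergence `∇ · f`. -/
def divergence (f : VField) (z : ℝ × ℝ) : ℝ := (partialX f z).1 + (partialY f z).2

/-- The scalar vorticity, the component of `∇ × f` normal to the plane. -/
def vorticity (f : VField) (z : ℝ × ℝ) : ℝ := (partialX f z).2 - (partialY f z).1

/-- The advection `(a · ∇) f`, of a vector field or of a scalar function. -/
def advect {F : Type*} [NormedAddCommGroup F] [NormedSpace ℝ F]
    (a : VField) (f : ℝ × ℝ → F) (z : ℝ × ℝ) : F :=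
  (a z).1 • partialX f z + (a z).2 • partialY f z

/-- `(u, P)` is a classical solution on the time interval `[0, T]` of the incompressible Euler
equations `∂u/∂t + (u · ∇) u = -∇P`, `∇ · u = 0` on the torus. At the endpoints of `[0, T]` the time
derivative is one-sided. -/
structure IsEulerSolution (T : ℝ) (u : ℝ → VField) (P : ℝ → ℝ × ℝ → ℝ) : Prop where
  regular : ContDiffOn ℝ 2 (fun q : ℝ × (ℝ × ℝ) => u q.1 q.2) (Icc 0 T ×ˢ univ)
  pressure_regular : ∀ t ∈ Icc 0 T, ContDiff ℝ 2 (P t)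
  periodic : ∀ t ∈ Icc 0 T, PeriodicField (u t)
  pressure_periodic : ∀ t ∈ Icc 0 T, PeriodicField (P t)
  momentum : ∀ t ∈ Icc 0 T, ∀ z : ℝ × ℝ,
    HasDerivWithinAt (fun s => u s z) (-advect (u t) (u t) z - grad (P t) z) (Icc 0 T) t
  incompressible : ∀ t ∈ Icc 0 T, ∀ z : ℝ × ℝ, divergence (u t) z = 0

/-- `(v, p)` satisfies the Euler equations linearized about the stationary flow `U`:
`∂v/∂t = -(U · ∇) v - (v · ∇) U - ∇p`, `∇ · v = 0`. -/
structure SolvesLinearizedEuler (U : VField) (v : ℝ → VField) (p : ℝ → ℝ × ℝ → ℝ) : Prop where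
  momentum : ∀ (t : ℝ) (z : ℝ × ℝ),
    HasDerivAt (fun s => v s z) (-advect U (v t) z - advect (v t) U z - grad (p t) z) t
  incompressible : ∀ (t : ℝ) (z : ℝ × ℝ), divergence (v t) z = 0

/-- The equilibrium `u₀(x, y) = (U₀ sin (m y), 0)`. -/
def shearFlow (U₀ : ℝ) (m : ℕ) : VField := fun z => (U₀ * sin (m * z.2), 0)

/-- The real part of the complex mode `e^{γ t + i k x} h(y)`. -/
def modeFunction (k : ℕ) (γ : ℝ) (h : ℝ → ℂ) (t : ℝ) (z : ℝ × ℝ) : ℝ :=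
  (Complex.exp ((γ : ℂ) * (t : ℂ) + Complex.I * (k : ℂ) * (z.1 : ℂ)) * h z.2).re

/-- The velocity `(-∂ψ/∂y, ∂ψ/∂x)` with stream function `ψ = Re (e^{γ t + i k x} χ(y))`. -/
def modeVelocity (k : ℕ) (γ : ℝ) (χ : ℝ → ℂ) (t : ℝ) : VField := fun z =>
  (-partialY (modeFunction k γ χ t) z, partialX (modeFunction k γ χ t) z)

/-- `χ` and `ϖ` are the stream function profile and the pressure profile of a smooth normal mode of
wavenumber `k`, growing at the real rate `γ > 0`, of the Euler equations linearized about
`shearFlow U₀ m`. -/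
structure IsGrowingMode (U₀ : ℝ) (m k : ℕ) (γ : ℝ) (χ ϖ : ℝ → ℂ) : Prop where
  rate_pos : 0 < γ
  smooth : ContDiff ℝ ∞ χ
  periodic : Function.Periodic χ (2 * π)
  pressure_smooth : ContDiff ℝ ∞ ϖ
  pressure_periodic : Function.Periodic ϖ (2 * π)
  linearized : SolvesLinearizedEuler (shearFlow U₀ m) (modeVelocity k γ χ) (modeFunction k γ ϖ)

/-- The upper growth rate bound `γ_u = U₀ k √((m² - k²) / (2 (m² + k²)))`. -/
def gammaU (U₀ : ℝ) (m k : ℕ) : ℝ :=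
  U₀ * k * √((1 / 2) * (((m : ℝ) ^ 2 - (k : ℝ) ^ 2) / ((m : ℝ) ^ 2 + (k : ℝ) ^ 2)))

/-- The end `γ_u⁻¹ log (1/ε)` of the time interval. -/
def finalTime (U₀ : ℝ) (m k : ℕ) (ε : ℝ) : ℝ := (gammaU U₀ m k)⁻¹ * log (1 / ε)

/-- The linearized solution `u₀ + ε ṽ`, where `ṽ` is the velocity of the mode. -/
def linearizedFlow (U₀ : ℝ) (m k : ℕ) (γ : ℝ) (χ : ℝ → ℂ) (ε t : ℝ) : VField := fun z =>
  shearFlow U₀ m z + ε • modeVelocity k γ χ t z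

/-- The constants `α, β, b₁, b₂`: positive, with `α β > 2 γ_u`, such that, uniformly in `ε ∈ (0, 1)`
and in `t ∈ [0, γ_u⁻¹ log (1/ε)]`, the linearized solution `ũ` satisfies `‖ũ‖_∞ ≤ α²` and
`‖∇ω_ũ‖_∞ ≤ β²`, and such that `‖(ṽ · ∇) ṽ‖_{L²} ≤ b₁ e^{2 γ_u t}` and
`‖ṽ · ∇ω_ṽ‖_{L²} ≤ b₂ e^{2 γ_u t}` for `t ≥ 0`. -/
structure AdmissibleConstants (U₀ : ℝ) (m k : ℕ) (γ : ℝ) (χ : ℝ → ℂ) (α β b₁ b₂ : ℝ) : Prop where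
  alpha_pos : 0 < α
  beta_pos : 0 < β
  b₁_pos : 0 < b₁
  b₂_pos : 0 < b₂
  rate : 2 * gammaU U₀ m k < α * β
  velocity_bound : ∀ ε ∈ Ioo (0 : ℝ) 1, ∀ t ∈ Icc 0 (finalTime U₀ m k ε), ∀ z : ℝ × ℝ,
    vecLength (linearizedFlow U₀ m k γ χ ε t z) ≤ α ^ 2
  vorticity_bound : ∀ ε ∈ Ioo (0 : ℝ) 1, ∀ t ∈ Icc 0 (finalTime U₀ m k ε), ∀ z : ℝ × ℝ,
    vecLength (grad (vorticity (linearizedFlow U₀ m k γ χ ε t)) z) ≤ β ^ 2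
  velocity_forcing : ∀ t : ℝ, 0 ≤ t →
    fieldL2 (advect (modeVelocity k γ χ t) (modeVelocity k γ χ t))
      ≤ b₁ * exp (2 * gammaU U₀ m k * t)
  vorticity_forcing : ∀ t : ℝ, 0 ≤ t →
    scalarL2 (advect (modeVelocity k γ χ t) (vorticity (modeVelocity k γ χ t)))
      ≤ b₂ * exp (2 * gammaU U₀ m k * t)

end EulerTorus

end

/-! Write `w` for the linearized flow. Since the shear flow is stationary and the mode solves the
linearized equations, `w` solves the Euler equations exactly up to the quadratic forcing `f = ε² (ṽ
· ∇) ṽ`. The error `η = u - w` is therefore driven only by `f`, of size `ε² e^{2 γ_u t}`.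

Two energy estimates are coupled. In the velocity equation, `(u · ∇) u` is a gradient plus `ω_u
u^⊥`. Tested against `η`, gradients integrate to zero and `ω_u η^⊥` is orthogonal to `η`, so only
`ω_η w^⊥` survives (`integral_momentum_difference_le`). In the vorticity equation, transport by the
divergence-free `u` preserves the norm of `ω_η`, and only `η · ∇ω_w` survives
(`integral_vorticity_difference_le`). With `x = ‖η‖` and `y = ‖ω_η‖`, this reads `x' ≤ α² y + ε² b₁
e^{gt}` and `y' ≤ β² x + ε² b₂ e^{gt}`, where `g = 2 γ_u`. The matrix of this system has eigenvalues
`±αβ`. Duhamel's formula with kernels `cosh (αβ (T - t))` and `(α/β) sinh (αβ (T - t))`, together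
with `cosh ≤ exp` and `sinh ≤ exp / 2` on the nonnegative half-line, produces `κ`
(`coupled_gronwall`).

Admissible constants exist as soon as `γ ≤ γ_u`: every derivative of the mode is then `O(e^{γ_u
t})`, and `ε e^{γ_u t} ≤ 1` on the time interval. For a profile of period `2π/m` this rate bound is
proved in `growth_rate_le`, unless the profile vanishes. Eliminating the pressure gives the Rayleigh
equation. Its energy balance and Wirtinger's inequality bound the oscillating part of `χ` by its
mean `c`; the mean of the equation bounds `γ |c|` by the oscillating part. Together they give `γ² ≤
γ_u²` when `c ≠ 0`, and `χ = 0` when `c = 0`. -/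

namespace EulerTorus

open MeasureTheory Filter Topology

/-! ### Integration over the periodic cell -/

/-- The half-open period cell `[0, 2π)²`. -/
def cell : Set (ℝ × ℝ) := Ico 0 (2 * π) ×ˢ Ico 0 (2 * π)

lemma measurableSet_cell : MeasurableSet cell := measurableSet_Ico.prod measurableSet_Ico

lemma cell_subset_Icc : cell ⊆ Icc ((0, 0) : ℝ × ℝ) (2 * π, 2 * π) := by
  rw [← Icc_prod_Icc]
  exact prod_mono Ico_subset_Icc_self Ico_subset_Icc_self

lemma cell_ae_eq_Icc : cell =ᵐ[volume] Icc ((0, 0) : ℝ × ℝ) (2 * π, 2 * π) := by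
  rw [← Icc_prod_Icc]
  exact Measure.set_prod_ae_eq Ico_ae_eq_Icc Ico_ae_eq_Icc

lemma volume_cell : volume.real cell = (2 * π) ^ 2 := by
  have h : volume cell = ENNReal.ofReal (2 * π) * ENNReal.ofReal (2 * π) := by
    unfold cell
    rw [Measure.volume_eq_prod, Measure.prod_prod, Real.volume_Ico, sub_zero]
  have h2 : (0 : ℝ) ≤ 2 * π := by positivity
  rw [Measure.real, h, ENNReal.toReal_mul, ENNReal.toReal_ofReal h2]
  ring

instance : IsFiniteMeasure (volume.restrict cell) :=
  ⟨by
    rw [Measure.restrict_apply_univ]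
    exact (measure_mono cell_subset_Icc).trans_lt isCompact_Icc.measure_lt_top⟩

lemma integrableOn_cell {f : ℝ × ℝ → ℝ} (hf : Continuous f) : IntegrableOn f cell :=
  (hf.continuousOn.integrableOn_compact isCompact_Icc).mono_set cell_subset_Icc

/-- The divergence theorem for a periodic field of class `C¹`. -/
lemma integral_divergence_eq_zero {f g : ℝ × ℝ → ℝ} (hf : ContDiff ℝ 1 f) (hg : ContDiff ℝ 1 g)
    (hpf : PeriodicField f) (hpg : PeriodicField g) :
    ∫ z in cell, (partialX f z + partialY g z) = 0 := by
  have hcont : Continuous fun z => fderiv ℝ f z (1, 0) + fderiv ℝ g z (0, 1) :=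
    ((hf.continuous_fderiv one_ne_zero).clm_apply continuous_const).add
      ((hg.continuous_fderiv one_ne_zero).clm_apply continuous_const)
  have hle : ((0, 0) : ℝ × ℝ) ≤ (2 * π, 2 * π) :=
    ⟨by simp [pi_pos.le], by simp [pi_pos.le]⟩
  have h := integral_divergence_prod_Icc_of_hasFDerivAt_of_le f g (fderiv ℝ f) (fderiv ℝ g)
    (0, 0) (2 * π, 2 * π) hle hf.continuous.continuousOn hg.continuous.continuousOn
    (fun z _ => (hf.differentiable one_ne_zero z).hasFDerivAt)
    (fun z _ => (hg.differentiable one_ne_zero z).hasFDerivAt)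
    (hcont.continuousOn.integrableOn_compact isCompact_Icc)
  -- By periodicity the fluxes through opposite sides of the cell cancel.
  have h1 : ∀ x, g (x, 2 * π) = g (x, 0) := fun x => by simpa using (hpg x 0).2
  have h2 : ∀ y, f (2 * π, y) = f (0, y) := fun y => by simpa using (hpf 0 y).1
  simp only [h1, h2, sub_self, zero_add] at h
  rw [setIntegral_congr_set cell_ae_eq_Icc]
  exact h

lemma scalarL2_eq (f : ℝ × ℝ → ℝ) : scalarL2 f = √(∫ z in cell, f z ^ 2) := rfl

lemma scalarL2_nonneg (f : ℝ × ℝ → ℝ) : 0 ≤ scalarL2 f := Real.sqrt_nonneg _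

lemma fieldL2_nonneg (f : VField) : 0 ≤ fieldL2 f := Real.sqrt_nonneg _

lemma scalarL2_sq (f : ℝ × ℝ → ℝ) : scalarL2 f ^ 2 = ∫ z in cell, f z ^ 2 :=
  Real.sq_sqrt (integral_nonneg fun z => sq_nonneg (f z))

lemma vecLength_nonneg (w : ℝ × ℝ) : 0 ≤ vecLength w := Real.sqrt_nonneg _

lemma vecLength_sq (w : ℝ × ℝ) : vecLength w ^ 2 = w.1 ^ 2 + w.2 ^ 2 :=
  Real.sq_sqrt (by positivity)

lemma fieldL2_sq (f : VField) : fieldL2 f ^ 2 = ∫ z in cell, ((f z).1 ^ 2 + (f z).2 ^ 2) := by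
  rw [fieldL2, scalarL2_sq]
  simp only [vecLength_sq]

@[fun_prop]
lemma continuous_vecLength : Continuous vecLength := by
  unfold vecLength
  fun_prop

lemma abs_dot_le (a b : ℝ × ℝ) : |a.1 * b.1 + a.2 * b.2| ≤ vecLength a * vecLength b := by
  rw [vecLength, vecLength, ← Real.sqrt_mul (by positivity)]
  apply Real.abs_le_sqrt
  nlinarith [sq_nonneg (a.1 * b.2 - a.2 * b.1)]

lemma abs_cross_le (a b : ℝ × ℝ) : |a.1 * b.2 - a.2 * b.1| ≤ vecLength a * vecLength b := by
  rw [vecLength, vecLength, ← Real.sqrt_mul (by positivity)]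
  apply Real.abs_le_sqrt
  nlinarith [sq_nonneg (a.1 * b.1 + a.2 * b.2)]

lemma vecLength_le_add (w : ℝ × ℝ) : vecLength w ≤ |w.1| + |w.2| := by
  apply Real.sqrt_le_iff.2 ⟨by positivity, ?_⟩
  nlinarith [sq_abs w.1, sq_abs w.2, abs_nonneg w.1, abs_nonneg w.2,
    mul_nonneg (abs_nonneg w.1) (abs_nonneg w.2)]

/-- The Cauchy–Schwarz inequality on the cell. -/
lemma integral_mul_le_scalarL2 {f g : ℝ × ℝ → ℝ} (hf : Continuous f) (hg : Continuous g) :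
    ∫ z in cell, f z * g z ≤ scalarL2 f * scalarL2 g := by
  set A := ∫ z in cell, f z ^ 2
  set B := ∫ z in cell, f z * g z
  set C := ∫ z in cell, g z ^ 2
  -- A quadratic polynomial in `s` that is an integral of squares has nonpositive discriminant.
  have key : ∀ s : ℝ, 0 ≤ A * (s * s) + 2 * B * s + C := by
    intro s
    have h : ∫ z in cell, (s * f z + g z) ^ 2 = A * (s * s) + 2 * B * s + C := by
      have e : ∀ z, (s * f z + g z) ^ 2 = s * s * f z ^ 2 + 2 * s * (f z * g z) + g z ^ 2 :=
        fun z => by ring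
      simp only [e]
      rw [integral_add, integral_add, integral_const_mul, integral_const_mul]
      · ring
      all_goals exact integrableOn_cell (by fun_prop)
    rw [← h]
    exact integral_nonneg fun z => sq_nonneg _
  have hd := discrim_le_zero key
  rw [discrim] at hd
  rw [scalarL2_eq, scalarL2_eq, ← Real.sqrt_mul (integral_nonneg fun z => sq_nonneg (f z))]
  exact Real.le_sqrt_of_sq_le (by nlinarith)

lemma integral_le_scalarL2_mul {h f g : ℝ × ℝ → ℝ} (hh : Continuous h) (hf : Continuous f)
    (hg : Continuous g) (hle : ∀ z, h z ≤ f z * g z) :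
    ∫ z in cell, h z ≤ scalarL2 f * scalarL2 g :=
  (setIntegral_mono (integrableOn_cell hh) (integrableOn_cell (hf.mul hg)) hle).trans
    (integral_mul_le_scalarL2 hf hg)

/-- The factor `2π` is the square root of the area of the cell. -/
lemma scalarL2_le_of_bound {f : ℝ × ℝ → ℝ} {C : ℝ} (hC : 0 ≤ C) (h : ∀ z, |f z| ≤ C) :
    scalarL2 f ≤ 2 * π * C := by
  rw [scalarL2_eq]
  apply Real.sqrt_le_iff.2 ⟨by positivity, ?_⟩
  have h1 : ∫ z in cell, f z ^ 2 ≤ C ^ 2 * volume.real cell := by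
    refine (le_abs_self _).trans ?_
    rw [← Real.norm_eq_abs]
    refine norm_setIntegral_le_of_norm_le_const (measure_lt_top_of_subset cell_subset_Icc
      isCompact_Icc.measure_lt_top.ne) fun z _ => ?_
    rw [Real.norm_eq_abs, abs_pow]
    exact pow_le_pow_left₀ (abs_nonneg _) (h z) 2
  rw [volume_cell] at h1
  linarith [h1, mul_pow (2 * π) C 2, mul_comm (C ^ 2) ((2 * π) ^ 2)]

/-! ### Functions on a space-time slab -/

/-- The space-time slab `[0, T] × ℝ²`. -/
def slab (T : ℝ) : Set (ℝ × (ℝ × ℝ)) := Icc 0 T ×ˢ univ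

lemma uniqueDiffOn_slab {T : ℝ} (hT : 0 < T) : UniqueDiffOn ℝ (slab T) :=
  (uniqueDiffOn_Icc hT).prod uniqueDiffOn_univ

lemma slab_mem_nhds {T t : ℝ} (ht : t ∈ Ioo 0 T) (z : ℝ × ℝ) : slab T ∈ 𝓝 (t, z) :=
  prod_mem_nhds (Icc_mem_nhds ht.1 ht.2) univ_mem

section

variable {E : Type*} [NormedAddCommGroup E] [NormedSpace ℝ E]

lemma contDiff_slice {n : ℕ∞ω} {T t : ℝ} {F : ℝ → ℝ × ℝ → E}
    (hF : ContDiffOn ℝ n (fun q : ℝ × (ℝ × ℝ) => F q.1 q.2) (slab T)) (ht : t ∈ Icc 0 T) :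
    ContDiff ℝ n (F t) := by
  have h1 : ContDiffOn ℝ n (fun z : ℝ × ℝ => ((t, z) : ℝ × (ℝ × ℝ))) univ :=
    (contDiff_const.prodMk contDiff_id).contDiffOn
  have h2 := hF.comp h1 (fun z _ => ⟨ht, mem_univ _⟩)
  exact contDiffOn_univ.1 h2

/-- A spatial derivative is the within-derivative on the slab in the direction `(0, e)`, also at the
end times, because the slab contains the whole slice through each of its points. Unique
differentiability of the slab is what requires `0 < T`. -/
lemma contDiffOn_fderiv_slice {T : ℝ} (hT : 0 < T) {F : ℝ → ℝ × ℝ → E} {m n : ℕ∞ω}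
    (hF : ContDiffOn ℝ n (fun q : ℝ × (ℝ × ℝ) => F q.1 q.2) (slab T)) (hmn : m + 1 ≤ n)
    (e : ℝ × ℝ) :
    ContDiffOn ℝ m (fun q : ℝ × (ℝ × ℝ) => fderiv ℝ (F q.1) q.2 e) (slab T) := by
  have h1 := hF.fderivWithin (uniqueDiffOn_slab hT) hmn
  have h2 : ContDiffOn ℝ m (fun q : ℝ × (ℝ × ℝ) =>
      fderivWithin ℝ (fun q : ℝ × (ℝ × ℝ) => F q.1 q.2) (slab T) q (0, e)) (slab T) :=
    h1.clm_apply contDiffOn_const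
  refine h2.congr fun q hq => ?_
  have hn : n ≠ 0 := by
    rintro rfl
    simp at hmn
  have h3 := (hF.differentiableOn hn q hq).hasFDerivWithinAt
  have h4 : HasFDerivWithinAt (fun z : ℝ × ℝ => ((q.1, z) : ℝ × (ℝ × ℝ)))
      (ContinuousLinearMap.inr ℝ ℝ (ℝ × ℝ)) univ q.2 := (hasFDerivAt_prodMk_right q.1 q.2).hasFDerivWithinAt
  have h5 := HasFDerivWithinAt.comp q.2 (g := fun q : ℝ × (ℝ × ℝ) => F q.1 q.2) (t := slab T) h3 h4
    (fun z _ => ⟨hq.1, mem_univ _⟩)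
  have h6 : HasFDerivAt (F q.1) _ q.2 := hasFDerivWithinAt_univ.1 h5
  rw [h6.fderiv]
  simp

/-- The time derivative commutes with spatial derivatives. -/
lemma hasDerivAt_fderiv_slice {T t : ℝ} {F : ℝ → ℝ × ℝ → E} {g : ℝ × ℝ → E}
    (hF : ContDiffOn ℝ 2 (fun q : ℝ × (ℝ × ℝ) => F q.1 q.2) (slab T)) (ht : t ∈ Ioo 0 T)
    (hg : ∀ z, HasDerivAt (fun s => F s z) (g z) t) (z e : ℝ × ℝ) :
    HasDerivAt (fun s => fderiv ℝ (F s) z e) (fderiv ℝ g z e) t := by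
  set F₁ : ℝ × (ℝ × ℝ) → E := fun q => F q.1 q.2 with hF₁
  have hat : ∀ s ∈ Ioo 0 T, ∀ w, ContDiffAt ℝ 2 F₁ (s, w) := fun s hs w =>
    hF.contDiffAt (slab_mem_nhds hs w)
  have hd : ∀ s ∈ Ioo 0 T, ∀ w, HasFDerivAt F₁ (fderiv ℝ F₁ (s, w)) (s, w) := fun s hs w =>
    ((hat s hs w).differentiableAt two_ne_zero).hasFDerivAt
  have hspace : ∀ s ∈ Ioo 0 T, ∀ w, fderiv ℝ (F s) w e = fderiv ℝ F₁ (s, w) (0, e) := by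
    intro s hs w
    have h := HasFDerivAt.comp w (g := F₁) (hd s hs w) (hasFDerivAt_prodMk_right s w)
    have h' : HasFDerivAt (F s) _ w := h
    rw [h'.fderiv]
    simp
  have htime : ∀ w, g w = fderiv ℝ F₁ (t, w) (1, 0) := by
    intro w
    have h := HasFDerivAt.comp t (g := F₁) (hd t ht w) (hasFDerivAt_prodMk_left (𝕜 := ℝ) t w)
    have h' := h.hasDerivAt
    have h'' := (hg w).unique h'
    simpa using h''
  have h2 : HasFDerivAt (fderiv ℝ F₁) (fderiv ℝ (fderiv ℝ F₁) (t, z)) (t, z) :=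
    (((hat t ht z).fderiv_right (m := 1) (by norm_num)).differentiableAt one_ne_zero).hasFDerivAt
  -- Both sides are the second derivative of `F₁` at `(t, z)` in the directions `(1, 0)` and `(0,
  -- e)`, taken in the two orders.
  have hsymm := (hat t ht z).isSymmSndFDerivAt (by simp)
  have e1 : HasDerivAt (fun s => fderiv ℝ F₁ (s, z) (0, e))
      (fderiv ℝ (fderiv ℝ F₁) (t, z) (1, 0) (0, e)) t := by
    have h := HasFDerivAt.comp t (g := fderiv ℝ F₁) h2 (hasFDerivAt_prodMk_left (𝕜 := ℝ) t z)
    have h' := h.hasDerivAt.clm_apply (hasDerivAt_const t ((0 : ℝ), e))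
    simpa using h'
  have e2 : HasFDerivAt (fun w => fderiv ℝ F₁ (t, w) (1, 0))
      ((ContinuousLinearMap.apply ℝ E ((1 : ℝ), (0 : ℝ × ℝ))).comp
        ((fderiv ℝ (fderiv ℝ F₁) (t, z)).comp (ContinuousLinearMap.inr ℝ ℝ (ℝ × ℝ)))) z := by
    have h := HasFDerivAt.comp z (g := fderiv ℝ F₁) h2 (hasFDerivAt_prodMk_right t z)
    exact (ContinuousLinearMap.apply ℝ E ((1 : ℝ), (0 : ℝ × ℝ))).hasFDerivAt.comp z h
  have hgeq : g = fun w => fderiv ℝ F₁ (t, w) (1, 0) := funext htime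
  rw [hgeq, e2.fderiv]
  have e3 : HasDerivAt (fun s => fderiv ℝ (F s) z e)
      (fderiv ℝ (fderiv ℝ F₁) (t, z) (1, 0) (0, e)) t := by
    refine e1.congr_of_eventuallyEq ?_
    filter_upwards [Ioo_mem_nhds ht.1 ht.2] with s hs using hspace s hs z
  convert e3 using 1
  simpa using hsymm (0, e) (1, 0)

end

/-- Freezing time outside `[0, T]` by `projIcc` makes the integrand continuous everywhere, so
continuity of parametric integrals over a compact set applies. -/
lemma continuousOn_integral_cell {T : ℝ} (hT : 0 ≤ T) {G : ℝ → ℝ × ℝ → ℝ}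
    (hG : ContinuousOn (fun q : ℝ × (ℝ × ℝ) => G q.1 q.2) (slab T)) :
    ContinuousOn (fun t => ∫ z in cell, G t z) (Icc 0 T) := by
  have h1 : Continuous fun q : ℝ × (ℝ × ℝ) => G (projIcc 0 T hT q.1) q.2 := by
    have h2 : Continuous fun q : ℝ × (ℝ × ℝ) => (((projIcc 0 T hT q.1 : ℝ), q.2) : ℝ × (ℝ × ℝ)) := by
      fun_prop
    exact hG.comp_continuous h2 fun q => ⟨(projIcc 0 T hT q.1).2, mem_univ _⟩
  have h3 := continuous_parametric_integral_of_continuous (μ := volume)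
    (f := fun t z => G (projIcc 0 T hT t) z) h1 (isCompact_Icc (a := ((0, 0) : ℝ × ℝ)) (b := (2 * π, 2 * π)))
  refine h3.continuousOn.congr fun t ht => ?_
  simp only [projIcc_of_mem hT ht]
  exact setIntegral_congr_set cell_ae_eq_Icc

/-- Differentiation under the integral sign: near an interior time, the time derivative is bounded
on a compact neighbourhood times the closed cell, and that constant dominates. -/
lemma hasDerivAt_integral_cell {T t : ℝ} {G : ℝ → ℝ × ℝ → ℝ} {G' : ℝ × ℝ → ℝ}
    (hG : ContDiffOn ℝ 1 (fun q : ℝ × (ℝ × ℝ) => G q.1 q.2) (slab T)) (ht : t ∈ Ioo 0 T)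
    (hG' : ∀ z, HasDerivAt (fun s => G s z) (G' z) t) :
    HasDerivAt (fun s => ∫ z in cell, G s z) (∫ z in cell, G' z) t := by
  set G₁ : ℝ × (ℝ × ℝ) → ℝ := fun q => G q.1 q.2 with hG₁
  have hat : ∀ s ∈ Ioo 0 T, ∀ w, ContDiffAt ℝ 1 G₁ (s, w) := fun s hs w =>
    hG.contDiffAt (slab_mem_nhds hs w)
  have htime : ∀ s ∈ Ioo 0 T, ∀ w, HasDerivAt (fun s => G s w) (fderiv ℝ G₁ (s, w) (1, 0)) s := by
    intro s hs w
    have h := HasFDerivAt.comp s (g := G₁) ((hat s hs w).differentiableAt one_ne_zero).hasFDerivAt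
      (hasFDerivAt_prodMk_left (𝕜 := ℝ) s w)
    have h' : HasDerivAt (fun s => G s w) _ s := h.hasDerivAt
    simpa using h'
  have hcont : ContinuousOn (fun q : ℝ × (ℝ × ℝ) => fderiv ℝ G₁ q (1, 0)) (Ioo 0 T ×ˢ univ) := by
    intro q hq
    have h := ((hat q.1 hq.1 q.2).fderiv_right (m := 0) (by norm_num)).continuousAt
    exact (h.clm_apply continuousAt_const).continuousWithinAt
  obtain ⟨r, hr, hrs⟩ := Metric.nhds_basis_closedBall.mem_iff.1 (Ioo_mem_nhds ht.1 ht.2)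
  have hsub : Metric.closedBall t r ×ˢ Icc ((0, 0) : ℝ × ℝ) (2 * π, 2 * π) ⊆ Ioo 0 T ×ˢ univ :=
    prod_mono hrs (subset_univ _)
  obtain ⟨C, hC⟩ := ((isCompact_closedBall t r).prod isCompact_Icc).exists_bound_of_continuousOn
    (hcont.mono hsub)
  have hslice : ∀ s ∈ Ioo 0 T, Continuous (G s) := fun s hs =>
    (contDiff_slice hG (Ioo_subset_Icc_self hs)).continuous
  have hG'eq : G' = fun z => fderiv ℝ G₁ (t, z) (1, 0) :=
    funext fun z => (hG' z).unique (htime t ht z)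
  have hG'c : Continuous G' := by
    rw [hG'eq]
    exact hcont.comp_continuous (by fun_prop : Continuous fun z : ℝ × ℝ => (t, z))
      fun z => ⟨ht, mem_univ _⟩
  have key := hasDerivAt_integral_of_dominated_loc_of_deriv_le (μ := volume.restrict cell)
    (F := G) (F' := fun s z => fderiv ℝ G₁ (s, z) (1, 0)) (x₀ := t) (bound := fun _ => C)
    (s := Metric.closedBall t r) (Metric.closedBall_mem_nhds t hr)
    (by
      filter_upwards [Ioo_mem_nhds ht.1 ht.2] with s hs using (hslice s hs).aestronglyMeasurable)
    (integrableOn_cell (hslice t ht))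
    (by
      have := hG'c
      rw [hG'eq] at this
      exact this.aestronglyMeasurable)
    (by
      filter_upwards [ae_restrict_mem measurableSet_cell] with z hz s hs
      exact hC (s, z) ⟨hs, cell_subset_Icc hz⟩)
    (integrable_const C)
    (by
      filter_upwards with z s hs
      exact htime s (hrs hs) z)
  rw [hG'eq]
  exact key.2

/-! ### Differential identities in the plane -/

section

variable {f g h l : ℝ × ℝ → ℝ} {a b : VField} {z : ℝ × ℝ}

lemma fderiv_fst_apply (ha : DifferentiableAt ℝ a z) (e : ℝ × ℝ) :
    (fderiv ℝ a z e).1 = fderiv ℝ (fun z => (a z).1) z e := by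
  rw [ha.hasFDerivAt.fst.fderiv]
  rfl

lemma fderiv_snd_apply (ha : DifferentiableAt ℝ a z) (e : ℝ × ℝ) :
    (fderiv ℝ a z e).2 = fderiv ℝ (fun z => (a z).2) z e := by
  rw [ha.hasFDerivAt.snd.fderiv]
  rfl

lemma divergence_eq (ha : DifferentiableAt ℝ a z) :
    divergence a z = partialX (fun z => (a z).1) z + partialY (fun z => (a z).2) z := by
  rw [divergence, partialX, partialY, fderiv_fst_apply ha, fderiv_snd_apply ha, partialX, partialY]

lemma vorticity_eq (ha : DifferentiableAt ℝ a z) :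
    vorticity a z = partialX (fun z => (a z).2) z - partialY (fun z => (a z).1) z := by
  rw [vorticity, partialX, partialY, fderiv_fst_apply ha, fderiv_snd_apply ha, partialX, partialY]

lemma advect_field_eq (hb : DifferentiableAt ℝ b z) :
    advect a b z = ((a z).1 * partialX (fun z => (b z).1) z + (a z).2 * partialY (fun z => (b z).1) z,
      (a z).1 * partialX (fun z => (b z).2) z + (a z).2 * partialY (fun z => (b z).2) z) := by
  ext
  · simp [advect, partialX, partialY, fderiv_fst_apply hb]
  · simp [advect, partialX, partialY, fderiv_snd_apply hb]

lemma fderiv_mul_apply (hf : DifferentiableAt ℝ f z) (hg : DifferentiableAt ℝ g z) (e : ℝ × ℝ) :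
    fderiv ℝ (fun z => f z * g z) z e = f z * fderiv ℝ g z e + fderiv ℝ f z e * g z := by
  rw [fderiv_fun_mul hf hg]
  simp [mul_comm]

lemma fderiv_add_apply' (hf : DifferentiableAt ℝ f z) (hg : DifferentiableAt ℝ g z) (e : ℝ × ℝ) :
    fderiv ℝ (fun z => f z + g z) z e = fderiv ℝ f z e + fderiv ℝ g z e := by
  rw [fderiv_fun_add hf hg]
  rfl

lemma fderiv_sub_apply' (hf : DifferentiableAt ℝ f z) (hg : DifferentiableAt ℝ g z) (e : ℝ × ℝ) :
    fderiv ℝ (fun z => f z - g z) z e = fderiv ℝ f z e - fderiv ℝ g z e := by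
  rw [fderiv_fun_sub hf hg]
  rfl

lemma contDiff_fderiv_apply {E : Type*} [NormedAddCommGroup E] [NormedSpace ℝ E]
    {F : ℝ × ℝ → E} {m n : ℕ∞ω} (hF : ContDiff ℝ n F) (hmn : m + 1 ≤ n) (e : ℝ × ℝ) :
    ContDiff ℝ m fun z => fderiv ℝ F z e :=
  (hF.fderiv_right hmn).clm_apply contDiff_const

lemma contDiff_partialX {E : Type*} [NormedAddCommGroup E] [NormedSpace ℝ E]
    {F : ℝ × ℝ → E} {m n : ℕ∞ω} (hF : ContDiff ℝ n F) (hmn : m + 1 ≤ n) :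
    ContDiff ℝ m (partialX F) := contDiff_fderiv_apply hF hmn _

lemma contDiff_partialY {E : Type*} [NormedAddCommGroup E] [NormedSpace ℝ E]
    {F : ℝ × ℝ → E} {m n : ℕ∞ω} (hF : ContDiff ℝ n F) (hmn : m + 1 ≤ n) :
    ContDiff ℝ m (partialY F) := contDiff_fderiv_apply hF hmn _

lemma contDiff_vorticity {m n : ℕ∞ω} (ha : ContDiff ℝ n a) (hmn : m + 1 ≤ n) :
    ContDiff ℝ m (vorticity a) :=
  (contDiff_partialX ha hmn).snd.sub (contDiff_partialY ha hmn).fst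

lemma contDiff_grad {m n : ℕ∞ω} (hf : ContDiff ℝ n f) (hmn : m + 1 ≤ n) : ContDiff ℝ m (grad f) :=
  (contDiff_partialX hf hmn).prodMk (contDiff_partialY hf hmn)

lemma contDiff_advect {E : Type*} [NormedAddCommGroup E] [NormedSpace ℝ E]
    {F : ℝ × ℝ → E} {m n : ℕ∞ω} (ha : ContDiff ℝ m a) (hF : ContDiff ℝ n F) (hmn : m + 1 ≤ n) :
    ContDiff ℝ m (advect a F) :=
  (ha.fst.smul (contDiff_partialX hF hmn)).add (ha.snd.smul (contDiff_partialY hF hmn))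

lemma partialX_partialY_comm (hf : ContDiff ℝ 2 f) (z : ℝ × ℝ) :
    partialX (partialY f) z = partialY (partialX f) z := by
  have hsymm := (hf.contDiffAt (x := z)).isSymmSndFDerivAt (by simp)
  have hd : DifferentiableAt ℝ (fderiv ℝ f) z :=
    ((hf.fderiv_right (m := 1) (by norm_num)).differentiable one_ne_zero) z
  have h : ∀ e e' : ℝ × ℝ, fderiv ℝ (fun z => fderiv ℝ f z e) z e' = fderiv ℝ (fderiv ℝ f) z e' e := by
    intro e e'
    rw [(hd.hasFDerivAt.clm_apply (hasFDerivAt_const e z)).fderiv]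
    simp
  unfold partialX partialY
  rw [h, h]
  exact hsymm _ _

lemma vorticity_sub (ha : DifferentiableAt ℝ a z) (hb : DifferentiableAt ℝ b z) :
    vorticity (fun z => a z - b z) z = vorticity a z - vorticity b z := by
  simp only [vorticity, partialX, partialY]
  rw [fderiv_fun_sub ha hb]
  simp only [_root_.sub_apply, Prod.fst_sub, Prod.snd_sub]
  ring

lemma vorticity_add (ha : DifferentiableAt ℝ a z) (hb : DifferentiableAt ℝ b z) :
    vorticity (fun z => a z + b z) z = vorticity a z + vorticity b z := by
  simp only [vorticity, partialX, partialY]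
  rw [fderiv_fun_add ha hb]
  simp only [_root_.add_apply, Prod.fst_add, Prod.snd_add]
  ring

lemma vorticity_neg :
    vorticity (fun z => -a z) z = -vorticity a z := by
  simp only [vorticity, partialX, partialY]
  rw [fderiv_fun_neg]
  simp only [_root_.neg_apply, Prod.fst_neg, Prod.snd_neg]
  ring

lemma vorticity_const_smul (c : ℝ) (ha : DifferentiableAt ℝ a z) :
    vorticity (fun z => c • a z) z = c * vorticity a z := by
  simp only [vorticity, partialX, partialY]
  rw [fderiv_fun_const_smul ha]
  simp only [_root_.smul_apply, Prod.smul_fst, Prod.smul_snd, smul_eq_mul]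
  ring

lemma vorticity_grad (hf : ContDiff ℝ 2 f) (z : ℝ × ℝ) : vorticity (grad f) z = 0 := by
  have hd : ContDiff ℝ 1 (grad f) := contDiff_grad hf (by norm_num)
  rw [vorticity_eq (hd.differentiable one_ne_zero z)]
  exact sub_eq_zero.2 (partialX_partialY_comm hf z)

/-- The vorticity of the self-advection of a field. -/
lemma vorticity_advect_self (ha : ContDiff ℝ 2 a) (z : ℝ × ℝ) :
    vorticity (advect a a) z = advect a (vorticity a) z + divergence a z * vorticity a z := by
  have hda : Differentiable ℝ a := ha.differentiable two_ne_zero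
  have h1 : ContDiff ℝ 2 fun z => (a z).1 := ha.fst
  have h2 : ContDiff ℝ 2 fun z => (a z).2 := ha.snd
  have d1 := h1.differentiable two_ne_zero
  have d2 := h2.differentiable two_ne_zero
  have hx1 : Differentiable ℝ (partialX fun z => (a z).1) :=
    (contDiff_partialX (m := 1) h1 (by norm_num)).differentiable one_ne_zero
  have hx2 : Differentiable ℝ (partialX fun z => (a z).2) :=
    (contDiff_partialX (m := 1) h2 (by norm_num)).differentiable one_ne_zero
  have hy1 : Differentiable ℝ (partialY fun z => (a z).1) :=
    (contDiff_partialY (m := 1) h1 (by norm_num)).differentiable one_ne_zero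
  have hy2 : Differentiable ℝ (partialY fun z => (a z).2) :=
    (contDiff_partialY (m := 1) h2 (by norm_num)).differentiable one_ne_zero
  have hadv : Differentiable ℝ (advect a a) :=
    (contDiff_advect (m := 1) (n := 2) (ha.of_le (by norm_num)) ha (by norm_num)).differentiable one_ne_zero
  have hvort : vorticity a = fun z => partialX (fun z => (a z).2) z - partialY (fun z => (a z).1) z :=
    funext fun z => vorticity_eq (hda z)
  rw [vorticity_eq (hadv z)]
  simp only [fun z => advect_field_eq (a := a) (hda z)]
  rw [hvort, divergence_eq (hda z)]
  -- The second-order terms form the advection of the vorticity once mixed partials are exchanged;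
  -- the products of first derivatives factor as divergence times vorticity.
  have c1 := partialX_partialY_comm h1 z
  have c2 := partialX_partialY_comm h2 z
  simp only [advect, smul_eq_mul]
  unfold partialX partialY at *
  rw [fderiv_add_apply' ((d1 z).fun_mul (hx2 z)) ((d2 z).fun_mul (hy2 z)),
    fderiv_add_apply' ((d1 z).fun_mul (hx1 z)) ((d2 z).fun_mul (hy1 z)),
    fderiv_mul_apply (d1 z) (hx2 z), fderiv_mul_apply (d2 z) (hy2 z),
    fderiv_mul_apply (d1 z) (hx1 z), fderiv_mul_apply (d2 z) (hy1 z),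
    fderiv_sub_apply' (hx2 z) (hy1 z), fderiv_sub_apply' (hx2 z) (hy1 z)]
  linear_combination (a z).2 * c2 + (a z).1 * c1

end

lemma hasDerivAt_vorticity {T t : ℝ} {F : ℝ → VField} {g : VField}
    (hF : ContDiffOn ℝ 2 (fun q : ℝ × (ℝ × ℝ) => F q.1 q.2) (slab T)) (ht : t ∈ Ioo 0 T)
    (hg : ∀ z, HasDerivAt (fun s => F s z) (g z) t) (z : ℝ × ℝ) :
    HasDerivAt (fun s => vorticity (F s) z) (vorticity g z) t := by
  have h1 : HasDerivAt (fun s => (fderiv ℝ (F s) z (1, 0)).2) (fderiv ℝ g z (1, 0)).2 t :=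
    ((ContinuousLinearMap.snd ℝ ℝ ℝ).hasFDerivAt.comp_hasDerivAt t
      (hasDerivAt_fderiv_slice hF ht hg z (1, 0)))
  have h2 : HasDerivAt (fun s => (fderiv ℝ (F s) z (0, 1)).1) (fderiv ℝ g z (0, 1)).1 t :=
    ((ContinuousLinearMap.fst ℝ ℝ ℝ).hasFDerivAt.comp_hasDerivAt t
      (hasDerivAt_fderiv_slice hF ht hg z (0, 1)))
  exact h1.sub h2

lemma contDiffOn_vorticity {T : ℝ} (hT : 0 < T) {F : ℝ → VField}
    (hF : ContDiffOn ℝ 2 (fun q : ℝ × (ℝ × ℝ) => F q.1 q.2) (slab T)) :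
    ContDiffOn ℝ 1 (fun q : ℝ × (ℝ × ℝ) => vorticity (F q.1) q.2) (slab T) :=
  (contDiffOn_fderiv_slice hT hF (by norm_num) (1, 0)).snd.sub
    (contDiffOn_fderiv_slice hT hF (by norm_num) (0, 1)).fst

lemma periodicField_fderiv {E : Type*} [NormedAddCommGroup E] [NormedSpace ℝ E]
    {F : ℝ × ℝ → E} (hF : PeriodicField F) : PeriodicField (fderiv ℝ F) := by
  intro x y
  have h1 : (fun z => F (z + (2 * π, 0))) = F := by
    ext ⟨x, y⟩
    simpa using (hF x y).1
  have h2 : (fun z => F (z + (0, 2 * π))) = F := by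
    ext ⟨x, y⟩
    simpa using (hF x y).2
  constructor
  · have h := fderiv_comp_add_right (𝕜 := ℝ) (f := F) (x := (x, y)) (2 * π, 0)
    rw [h1] at h
    simpa using h.symm
  · have h := fderiv_comp_add_right (𝕜 := ℝ) (f := F) (x := (x, y)) (0, 2 * π)
    rw [h2] at h
    simpa using h.symm

lemma periodicField_vorticity {a : VField} (ha : PeriodicField a) : PeriodicField (vorticity a) := by
  intro x y
  have h := periodicField_fderiv ha x y
  simp only [vorticity, partialX, partialY, h.1, h.2, and_self]

/-! ### Energy identities at a fixed time -/

section

variable {u w f : ℝ × ℝ → ℝ × ℝ} {q : ℝ × ℝ → ℝ}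

/-- This rests on `(u · ∇) u = ∇(|u|²/2) + ω_u u^⊥` with `u^⊥ = (-u₂, u₁)`. For `η = u - w`, the
rotational parts differ by `ω_u η^⊥ + (ω_u - ω_w) w^⊥`, and the first summand is orthogonal to `η`.
Hence no gradient of `w` enters, only its size. -/
lemma dot_momentum_difference (hu : ContDiff ℝ 1 u) (hw : ContDiff ℝ 1 w) (hq : ContDiff ℝ 1 q)
    (z : ℝ × ℝ) (hdu : divergence u z = 0) (hdw : divergence w z = 0) :
    ((u z).1 - (w z).1) * (advect u u z - advect w w z + grad q z).1
      + ((u z).2 - (w z).2) * (advect u u z - advect w w z + grad q z).2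
    = partialX (fun z => ((u z).1 - (w z).1) *
          (1 / 2 * ((u z).1 * (u z).1 + (u z).2 * (u z).2 - ((w z).1 * (w z).1 + (w z).2 * (w z).2)) + q z)) z
      + partialY (fun z => ((u z).2 - (w z).2) *
          (1 / 2 * ((u z).1 * (u z).1 + (u z).2 * (u z).2 - ((w z).1 * (w z).1 + (w z).2 * (w z).2)) + q z)) z
      - (vorticity u z - vorticity w z)
          * (((u z).1 - (w z).1) * (w z).2 - ((u z).2 - (w z).2) * (w z).1) := by
  have du : DifferentiableAt ℝ u z := hu.differentiable one_ne_zero z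
  have dw : DifferentiableAt ℝ w z := hw.differentiable one_ne_zero z
  have dq : DifferentiableAt ℝ q z := hq.differentiable one_ne_zero z
  have u1 := du.fst
  have u2 := du.snd
  have w1 := dw.fst
  have w2 := dw.snd
  rw [divergence_eq du] at hdu
  rw [divergence_eq dw] at hdw
  rw [advect_field_eq du, advect_field_eq dw, vorticity_eq du, vorticity_eq dw]
  simp only [grad, Prod.fst_add, Prod.snd_add, Prod.fst_sub, Prod.snd_sub]
  have hK : ∀ e, fderiv ℝ (fun z => 1 / 2 * ((u z).1 * (u z).1 + (u z).2 * (u z).2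
        - ((w z).1 * (w z).1 + (w z).2 * (w z).2)) + q z) z e
      = (u z).1 * fderiv ℝ (fun z => (u z).1) z e + (u z).2 * fderiv ℝ (fun z => (u z).2) z e
        - (w z).1 * fderiv ℝ (fun z => (w z).1) z e - (w z).2 * fderiv ℝ (fun z => (w z).2) z e
        + fderiv ℝ q z e := by
    intro e
    rw [fderiv_add_apply' (by fun_prop) dq, fderiv_mul_apply (by fun_prop) (by fun_prop),
      fderiv_sub_apply' (by fun_prop) (by fun_prop), fderiv_add_apply' (by fun_prop) (by fun_prop),
      fderiv_add_apply' (by fun_prop) (by fun_prop), fderiv_mul_apply u1 u1, fderiv_mul_apply u2 u2,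
      fderiv_mul_apply w1 w1, fderiv_mul_apply w2 w2]
    simp
    ring
  unfold partialX partialY at *
  rw [fderiv_mul_apply (by fun_prop) (by fun_prop), fderiv_mul_apply (by fun_prop) (by fun_prop),
    hK, hK, fderiv_sub_apply' u1 w1, fderiv_sub_apply' u2 w2]
  -- `∇ · (ηK) = η · ∇K + K ∇ · η`, and the last term vanishes since both flows are divergence-free.
  linear_combination (-(1 / 2 * ((u z).1 * (u z).1 + (u z).2 * (u z).2
    - ((w z).1 * (w z).1 + (w z).2 * (w z).2)) + q z)) * (hdu - hdw)

/-- The energy inequality for the difference of two incompressible flows: the advection terms are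
controlled by the maximum of `w` and the vorticity of the difference. -/
lemma integral_momentum_difference_le (hu : ContDiff ℝ 2 u) (hw : ContDiff ℝ 2 w)
    (hq : ContDiff ℝ 1 q) (hf : Continuous f) (pu : PeriodicField u) (pw : PeriodicField w)
    (pq : PeriodicField q) (hdu : ∀ z, divergence u z = 0) (hdw : ∀ z, divergence w z = 0)
    {M : ℝ} (hM : ∀ z, vecLength (w z) ≤ M) :
    ∫ z in cell, (((u z).1 - (w z).1) * (-(advect u u z - advect w w z + grad q z) - f z).1
      + ((u z).2 - (w z).2) * (-(advect u u z - advect w w z + grad q z) - f z).2)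
    ≤ M * (scalarL2 (fun z => vorticity u z - vorticity w z) * fieldL2 (fun z => u z - w z))
      + fieldL2 (fun z => u z - w z) * fieldL2 f := by
  have hu1 : ContDiff ℝ 1 u := hu.of_le (by norm_num)
  have hw1 : ContDiff ℝ 1 w := hw.of_le (by norm_num)
  -- The difference of the Bernoulli functions: kinetic energy densities plus the pressure
  -- difference `q`.
  set K : ℝ × ℝ → ℝ := fun z => 1 / 2 * ((u z).1 * (u z).1 + (u z).2 * (u z).2
    - ((w z).1 * (w z).1 + (w z).2 * (w z).2)) + q z with hK
  have hKc : ContDiff ℝ 1 K := by fun_prop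
  have pK : PeriodicField K := fun x y => by
    simp only [hK, (pu x y).1, (pu x y).2, (pw x y).1, (pw x y).2, (pq x y).1, (pq x y).2, and_self]
  set F : ℝ × ℝ → ℝ := fun z => ((u z).1 - (w z).1) * K z with hF
  set G : ℝ × ℝ → ℝ := fun z => ((u z).2 - (w z).2) * K z with hG
  have hFc : ContDiff ℝ 1 F := by fun_prop
  have hGc : ContDiff ℝ 1 G := by fun_prop
  have pF : PeriodicField F := fun x y => by
    simp only [hF, (pu x y).1, (pu x y).2, (pw x y).1, (pw x y).2, (pK x y).1, (pK x y).2, and_self]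
  have pG : PeriodicField G := fun x y => by
    simp only [hG, (pu x y).1, (pu x y).2, (pw x y).1, (pw x y).2, (pK x y).1, (pK x y).2, and_self]
  have cu : Continuous u := hu.continuous
  have cw : Continuous w := hw.continuous
  have cvu : Continuous (vorticity u) := (contDiff_vorticity (m := 1) hu (by norm_num)).continuous
  have cvw : Continuous (vorticity w) := (contDiff_vorticity (m := 1) hw (by norm_num)).continuous
  set A : ℝ × ℝ → ℝ := fun z => (vorticity u z - vorticity w z)
    * (((u z).1 - (w z).1) * (w z).2 - ((u z).2 - (w z).2) * (w z).1) with hA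
  set B : ℝ × ℝ → ℝ := fun z => -(((u z).1 - (w z).1) * (f z).1 + ((u z).2 - (w z).2) * (f z).2) with hB
  have hAc : Continuous A := by fun_prop
  have hBc : Continuous B := by fun_prop
  have hdiv : Continuous fun z => partialX F z + partialY G z :=
    (contDiff_partialX (m := 0) hFc (by norm_num)).continuous.add
      (contDiff_partialY (m := 0) hGc (by norm_num)).continuous
  have hpt : ∀ z, ((u z).1 - (w z).1) * (-(advect u u z - advect w w z + grad q z) - f z).1
      + ((u z).2 - (w z).2) * (-(advect u u z - advect w w z + grad q z) - f z).2
      = -(partialX F z + partialY G z) + A z + B z := by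
    intro z
    have h := dot_momentum_difference hu1 hw1 hq z (hdu z) (hdw z)
    simp only [Prod.fst_sub, Prod.snd_sub, Prod.fst_neg, Prod.snd_neg] at h ⊢
    linear_combination -h
  simp only [hpt]
  rw [integral_add, integral_add, integral_neg, integral_divergence_eq_zero hFc hGc pF pG, neg_zero,
    zero_add]
  rotate_left
  · exact integrableOn_cell hdiv.neg
  · exact integrableOn_cell hAc
  · exact integrableOn_cell (hdiv.neg.add hAc)
  · exact integrableOn_cell hBc
  have hM0 : 0 ≤ M := (vecLength_nonneg _).trans (hM 0)
  have habs : scalarL2 (fun z => |vorticity u z - vorticity w z|)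
      = scalarL2 (fun z => vorticity u z - vorticity w z) := by
    simp only [scalarL2, sq_abs]
  apply add_le_add
  · have hAle : ∀ z, A z ≤ M * (|vorticity u z - vorticity w z| * vecLength (u z - w z)) := by
      intro z
      have h1 := abs_cross_le (u z - w z) (w z)
      have h2 := mul_le_mul_of_nonneg_left (hM z) (vecLength_nonneg (u z - w z))
      calc A z ≤ |A z| := le_abs_self _
        _ = |vorticity u z - vorticity w z| * |(u z - w z).1 * (w z).2 - (u z - w z).2 * (w z).1| := by
          rw [hA, ← abs_mul]; rfl
        _ ≤ |vorticity u z - vorticity w z| * (vecLength (u z - w z) * M) :=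
          mul_le_mul_of_nonneg_left (h1.trans h2) (abs_nonneg _)
        _ = _ := by ring
    have hc : Continuous fun z => |vorticity u z - vorticity w z| * vecLength (u z - w z) := by fun_prop
    refine (setIntegral_mono (integrableOn_cell hAc) (integrableOn_cell (hc.const_mul M)) hAle).trans ?_
    rw [integral_const_mul]
    refine mul_le_mul_of_nonneg_left ?_ hM0
    refine (integral_mul_le_scalarL2 (f := fun z => |vorticity u z - vorticity w z|)
      (g := fun z => vecLength (u z - w z)) (by fun_prop) (by fun_prop)).trans_eq ?_
    rw [habs, fieldL2]
  · refine integral_le_scalarL2_mul hBc (by fun_prop) (by fun_prop) fun z => ?_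
    exact (neg_le_abs _).trans (abs_dot_le (u z - w z) (f z))

/-- The enstrophy inequality for the difference of two incompressible flows. -/
lemma integral_vorticity_difference_le (hu : ContDiff ℝ 2 u) (hw : ContDiff ℝ 2 w)
    {p r h : ℝ × ℝ → ℝ} (hp : ContDiff ℝ 1 p) (hr : ContDiff ℝ 1 r) (hh : Continuous h)
    (pu : PeriodicField u) (pp : PeriodicField p) (pr : PeriodicField r)
    (hdu : ∀ z, divergence u z = 0) {M : ℝ} (hM : ∀ z, vecLength (grad r z) ≤ M) :
    ∫ z in cell, (p z - r z) * (-(advect u p z - advect w r z) - h z)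
    ≤ M * (scalarL2 (fun z => p z - r z) * fieldL2 (fun z => u z - w z))
      + scalarL2 (fun z => p z - r z) * scalarL2 h := by
  have hu1 : ContDiff ℝ 1 u := hu.of_le (by norm_num)
  -- The flux `u (p - r)²`. In the splitting `u · ∇p - w · ∇r = u · ∇(p - r) + (u - w) · ∇r`, the
  -- first part times `p - r` is half the divergence of this flux.
  set F : ℝ × ℝ → ℝ := fun z => (u z).1 * ((p z - r z) * (p z - r z)) with hF
  set G : ℝ × ℝ → ℝ := fun z => (u z).2 * ((p z - r z) * (p z - r z)) with hG
  have hFc : ContDiff ℝ 1 F := by fun_prop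
  have hGc : ContDiff ℝ 1 G := by fun_prop
  have pF : PeriodicField F := fun x y => by
    simp only [hF, (pu x y).1, (pu x y).2, (pp x y).1, (pp x y).2, (pr x y).1, (pr x y).2, and_self]
  have pG : PeriodicField G := fun x y => by
    simp only [hG, (pu x y).1, (pu x y).2, (pp x y).1, (pp x y).2, (pr x y).1, (pr x y).2, and_self]
  have cu : Continuous u := hu.continuous
  have cw : Continuous w := hw.continuous
  have cp : Continuous p := hp.continuous
  have cr : Continuous r := hr.continuous
  set R : ℝ × ℝ → ℝ × ℝ := grad r with hR
  have cR : Continuous R := (contDiff_grad (m := 0) hr (by norm_num)).continuous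
  set A : ℝ × ℝ → ℝ := fun z => -((p z - r z)
    * (((u z).1 - (w z).1) * (R z).1 + ((u z).2 - (w z).2) * (R z).2)) with hA
  set B : ℝ × ℝ → ℝ := fun z => -((p z - r z) * h z) with hB
  have hAc : Continuous A := by fun_prop
  have hBc : Continuous B := by fun_prop
  have hdiv : Continuous fun z => (-(1 / 2 : ℝ)) * (partialX F z + partialY G z) :=
    continuous_const.mul ((contDiff_partialX (m := 0) hFc (by norm_num)).continuous.add
      (contDiff_partialY (m := 0) hGc (by norm_num)).continuous)
  have hpt : ∀ z, (p z - r z) * (-(advect u p z - advect w r z) - h z)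
      = (-(1 / 2)) * (partialX F z + partialY G z) + A z + B z := by
    intro z
    have du : DifferentiableAt ℝ u z := hu1.differentiable one_ne_zero z
    have dp : DifferentiableAt ℝ p z := hp.differentiable one_ne_zero z
    have dr : DifferentiableAt ℝ r z := hr.differentiable one_ne_zero z
    have hd := hdu z
    rw [divergence_eq du] at hd
    have hsq : ∀ e, fderiv ℝ (fun z => (p z - r z) * (p z - r z)) z e
        = 2 * (p z - r z) * (fderiv ℝ p z e - fderiv ℝ r z e) := by
      intro e
      rw [fderiv_mul_apply (by fun_prop) (by fun_prop), fderiv_sub_apply' dp dr]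
      ring
    simp only [hA, hB, hF, hG, hR, advect, grad, smul_eq_mul]
    unfold partialX partialY at *
    rw [fderiv_mul_apply du.fst (by fun_prop), fderiv_mul_apply du.snd (by fun_prop), hsq, hsq]
    linear_combination 1 / 2 * ((p z - r z) * (p z - r z)) * hd
  simp only [hpt]
  rw [integral_add, integral_add, integral_const_mul, integral_divergence_eq_zero hFc hGc pF pG,
    mul_zero, zero_add]
  rotate_left
  · exact integrableOn_cell hdiv
  · exact integrableOn_cell hAc
  · exact integrableOn_cell (hdiv.add hAc)
  · exact integrableOn_cell hBc
  have hM0 : 0 ≤ M := (vecLength_nonneg _).trans (hM 0)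
  have habs : scalarL2 (fun z => |p z - r z|) = scalarL2 (fun z => p z - r z) := by
    simp only [scalarL2, sq_abs]
  apply add_le_add
  · have hAle : ∀ z, A z ≤ M * (|p z - r z| * vecLength (u z - w z)) := by
      intro z
      have h1 := abs_dot_le (u z - w z) (R z)
      have h2 := mul_le_mul_of_nonneg_left (hM z) (vecLength_nonneg (u z - w z))
      calc A z ≤ |A z| := le_abs_self _
        _ = |p z - r z| * |(u z - w z).1 * (R z).1 + (u z - w z).2 * (R z).2| := by
          rw [hA, ← abs_mul, abs_neg]; rfl
        _ ≤ |p z - r z| * (vecLength (u z - w z) * M) :=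
          mul_le_mul_of_nonneg_left (h1.trans h2) (abs_nonneg _)
        _ = _ := by ring
    have hc : Continuous fun z => |p z - r z| * vecLength (u z - w z) := by fun_prop
    refine (setIntegral_mono (integrableOn_cell hAc) (integrableOn_cell (hc.const_mul M)) hAle).trans ?_
    rw [integral_const_mul]
    refine mul_le_mul_of_nonneg_left ?_ hM0
    refine (integral_mul_le_scalarL2 (f := fun z => |p z - r z|)
      (g := fun z => vecLength (u z - w z)) (by fun_prop) (by fun_prop)).trans_eq ?_
    rw [habs, fieldL2]
  · have habs' : scalarL2 (fun z => |h z|) = scalarL2 h := by simp only [scalarL2, sq_abs]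
    rw [← habs, ← habs']
    refine integral_le_scalarL2_mul hBc (by fun_prop) (by fun_prop) fun z => ?_
    rw [← abs_mul]
    exact neg_le_abs _

end

/-! ### A coupled Gronwall inequality -/

lemma hasDerivAt_sqrt_add_sq {N : ℝ → ℝ} {D t δ : ℝ} (hδ : 0 < δ) (hN : 0 ≤ N t)
    (h : HasDerivAt N D t) :
    HasDerivAt (fun s => √(N s + δ ^ 2)) (D / (2 * √(N t + δ ^ 2))) t :=
  (h.add_const (δ ^ 2)).sqrt (by positivity)

/-- Turns an inequality for the derivative of a squared norm into one for the derivative of the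
norm. The shift by `δ²` keeps the square root differentiable where the norm vanishes. -/
lemma div_sqrt_add_sq_le {n n' D a b δ : ℝ} (hδ : 0 < δ) (hn : 0 ≤ n) (ha : 0 ≤ a) (hb : 0 ≤ b)
    (h : D ≤ 2 * (a * (√n' * √n) + √n * b)) :
    D / (2 * √(n + δ ^ 2)) ≤ a * √(n' + δ ^ 2) + b := by
  have hpos : 0 < √(n + δ ^ 2) := Real.sqrt_pos.2 (by positivity)
  have h1 : √n ≤ √(n + δ ^ 2) := Real.sqrt_le_sqrt (by nlinarith [sq_nonneg δ])
  have h2 : √n' ≤ √(n' + δ ^ 2) := Real.sqrt_le_sqrt (by nlinarith [sq_nonneg δ])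
  rw [div_le_iff₀ (by positivity)]
  have h3 : √n' * √n ≤ √(n' + δ ^ 2) * √(n + δ ^ 2) := by gcongr
  nlinarith [mul_le_mul_of_nonneg_left h3 ha, mul_le_mul_of_nonneg_right h1 hb]

/-- The functional `G` below pairs `(X, Y)` with the first row of the propagator from time `t` to
`T` of the system `x' = α² y`, `y' = β² x`. Along the differential inequalities this pairing grows
only through the forcing, and the exponential term in `G` decreases fast enough to compensate.
Comparing `G T` with `G 0` gives the bound, up to an error proportional to `δ`. -/
lemma coupled_gronwall_aux {T α β g c₁ c₂ δ : ℝ} {N₁ N₂ D₁ D₂ : ℝ → ℝ} (hT : 0 ≤ T)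
    (hα : 0 < α) (hβ : 0 < β) (hg : g < α * β) (hg0 : 0 ≤ g) (hc₁ : 0 ≤ c₁) (hc₂ : 0 ≤ c₂)
    (hδ : 0 < δ)
    (hN₁ : ∀ t, 0 ≤ N₁ t) (hN₂ : ∀ t, 0 ≤ N₂ t)
    (hcont₁ : ContinuousOn N₁ (Icc 0 T)) (hcont₂ : ContinuousOn N₂ (Icc 0 T))
    (hd₁ : ∀ t ∈ Ioo 0 T, HasDerivAt N₁ (D₁ t) t) (hd₂ : ∀ t ∈ Ioo 0 T, HasDerivAt N₂ (D₂ t) t)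
    (hle₁ : ∀ t ∈ Ioo 0 T, D₁ t ≤ 2 * (α ^ 2 * (√(N₂ t) * √(N₁ t)) + √(N₁ t) * (c₁ * exp (g * t))))
    (hle₂ : ∀ t ∈ Ioo 0 T, D₂ t ≤ 2 * (β ^ 2 * (√(N₁ t) * √(N₂ t)) + √(N₂ t) * (c₂ * exp (g * t))))
    (h₁ : N₁ 0 = 0) (h₂ : N₂ 0 = 0) :
    √(N₁ T) ≤ 1 / (α * β - g) * (c₁ + α * c₂ / (2 * β)) * (exp (α * β * T) - 1)
      + δ * (cosh (α * β * T) + α / β * sinh (α * β * T)) := by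
  set s := α * β with hs
  have hs0 : 0 < s := mul_pos hα hβ
  set K := 1 / (s - g) * (c₁ + α * c₂ / (2 * β)) with hK
  have hsg : 0 < s - g := sub_pos.2 hg
  have hK0 : 0 ≤ K := by positivity
  -- This is the rate needed below: the forcing terms have total size at most `(c₁ + (α/β) c₂ / 2)
  -- e^{s (T - t)} e^{gt}`.
  have hKs : (s - g) * K = c₁ + α / β * c₂ / 2 := by
    rw [hK]
    field_simp
  set X : ℝ → ℝ := fun t => √(N₁ t + δ ^ 2) with hX
  set Y : ℝ → ℝ := fun t => √(N₂ t + δ ^ 2) with hY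
  set G : ℝ → ℝ := fun t => cosh (s * (T - t)) * X t + α / β * sinh (s * (T - t)) * Y t
    + K * exp (s * T - (s - g) * t) with hG
  have hGcont : ContinuousOn G (Icc 0 T) := by fun_prop
  have hGd : ∀ t ∈ Ioo 0 T, HasDerivAt G
      (sinh (s * (T - t)) * (-s) * X t + cosh (s * (T - t)) * (D₁ t / (2 * X t))
        + (α / β * (cosh (s * (T - t)) * (-s)) * Y t
          + α / β * sinh (s * (T - t)) * (D₂ t / (2 * Y t)))
        + K * (exp (s * T - (s - g) * t) * (-(s - g)))) t := by
    intro t ht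
    have e1 : HasDerivAt (fun t => s * (T - t)) (-s) t := by
      simpa using ((hasDerivAt_id t).const_sub T).const_mul s
    have e2 : HasDerivAt (fun t => s * T - (s - g) * t) (-(s - g)) t := by
      simpa using ((hasDerivAt_id t).const_mul (s - g)).const_sub (s * T)
    exact ((e1.cosh.mul (hasDerivAt_sqrt_add_sq hδ (hN₁ t) (hd₁ t ht))).add
      ((e1.sinh.const_mul (α / β)).mul (hasDerivAt_sqrt_add_sq hδ (hN₂ t) (hd₂ t ht)))).add
      (e2.exp.const_mul K)
  have hanti : AntitoneOn G (Icc 0 T) := by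
    apply antitoneOn_of_deriv_nonpos (convex_Icc 0 T) hGcont
    · intro t ht
      rw [interior_Icc] at ht
      exact (hGd t ht).differentiableAt.differentiableWithinAt
    · intro t ht
      rw [interior_Icc] at ht
      rw [(hGd t ht).deriv]
      have hx : 0 ≤ s * (T - t) := mul_nonneg hs0.le (sub_nonneg.2 ht.2.le)
      have i1 : D₁ t / (2 * X t) ≤ α ^ 2 * Y t + c₁ * exp (g * t) :=
        div_sqrt_add_sq_le hδ (hN₁ t) (by positivity) (by positivity) (hle₁ t ht)
      have i2 : D₂ t / (2 * Y t) ≤ β ^ 2 * X t + c₂ * exp (g * t) :=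
        div_sqrt_add_sq_le hδ (hN₂ t) (by positivity) (by positivity) (hle₂ t ht)
      have hsinh : 0 ≤ sinh (s * (T - t)) := Real.sinh_nonneg_iff.2 hx
      have hcosh : 0 ≤ cosh (s * (T - t)) := (Real.cosh_pos _).le
      have j1 := mul_le_mul_of_nonneg_left i1 hcosh
      have j2 := mul_le_mul_of_nonneg_left i2 (mul_nonneg (div_pos hα hβ).le hsinh)
      have k0 : exp (-(s * (T - t))) ≤ exp (s * (T - t)) := exp_le_exp.2 (by linarith)
      have k1 : cosh (s * (T - t)) ≤ exp (s * (T - t)) := by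
        rw [Real.cosh_eq]; linarith
      have k2 : sinh (s * (T - t)) ≤ exp (s * (T - t)) / 2 := by
        rw [Real.sinh_eq]; linarith [exp_pos (-(s * (T - t)))]
      have k3 : exp (s * T - (s - g) * t) = exp (s * (T - t)) * exp (g * t) := by
        rw [← exp_add]; congr 1; ring
      have hab : 0 ≤ α / β := (div_pos hα hβ).le
      have l1 := mul_le_mul_of_nonneg_right (mul_le_mul_of_nonneg_left k1 hc₁) (exp_pos (g * t)).le
      have l2 := mul_le_mul_of_nonneg_right
        (mul_le_mul_of_nonneg_left k2 (mul_nonneg hab hc₂)) (exp_pos (g * t)).le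
      -- These two identities make the homogeneous terms cancel: the time derivatives of the kernels
      -- absorb the coupling terms `α² Y` and `β² X`.
      have m1 : α / β * s = α ^ 2 := by rw [hs]; field_simp
      have m2 : α / β * β ^ 2 = s := by rw [hs]; field_simp
      rw [k3]
      have n1 : K * (exp (s * (T - t)) * exp (g * t) * -(s - g))
          = -((c₁ + α / β * c₂ / 2) * (exp (s * (T - t)) * exp (g * t))) := by
        rw [← hKs]; ring
      have n2 : α / β * (cosh (s * (T - t)) * -s) * Y t = -(α ^ 2 * cosh (s * (T - t)) * Y t) := by
        rw [← m1]; ring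
      have n3 : α / β * sinh (s * (T - t)) * (β ^ 2 * X t + c₂ * exp (g * t))
          = s * sinh (s * (T - t)) * X t + α / β * c₂ * sinh (s * (T - t)) * exp (g * t) := by
        rw [← m2]; ring
      rw [n1, n2]
      rw [n3] at j2
      linarith
  have hfin := hanti (left_mem_Icc.2 hT) (right_mem_Icc.2 hT) hT
  have hX0 : X 0 = δ := by simp [hX, h₁, Real.sqrt_sq hδ.le]
  have hY0 : Y 0 = δ := by simp [hY, h₂, Real.sqrt_sq hδ.le]
  simp only [hG, hX0, hY0, sub_self, mul_zero, Real.cosh_zero, Real.sinh_zero, zero_mul, sub_zero,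
    one_mul, add_zero] at hfin
  have h3 : √(N₁ T) ≤ X T := Real.sqrt_le_sqrt (by nlinarith [sq_nonneg δ])
  -- The exponential term of `G` at time `T` is `K e^{gT} ≥ K`; this is the source of the `-1` in
  -- the bound.
  have h4 : (1 : ℝ) ≤ exp (s * T - (s - g) * T) := Real.one_le_exp (by nlinarith)
  nlinarith [mul_le_mul_of_nonneg_left h4 hK0]

/-- The limit `δ → 0` of the regularized estimate; `δ` is chosen to make its error term equal to any
given `ε > 0`. -/
lemma coupled_gronwall {T α β g c₁ c₂ : ℝ} {N₁ N₂ D₁ D₂ : ℝ → ℝ} (hT : 0 ≤ T)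
    (hα : 0 < α) (hβ : 0 < β) (hg : g < α * β) (hg0 : 0 ≤ g) (hc₁ : 0 ≤ c₁) (hc₂ : 0 ≤ c₂)
    (hN₁ : ∀ t, 0 ≤ N₁ t) (hN₂ : ∀ t, 0 ≤ N₂ t)
    (hcont₁ : ContinuousOn N₁ (Icc 0 T)) (hcont₂ : ContinuousOn N₂ (Icc 0 T))
    (hd₁ : ∀ t ∈ Ioo 0 T, HasDerivAt N₁ (D₁ t) t) (hd₂ : ∀ t ∈ Ioo 0 T, HasDerivAt N₂ (D₂ t) t)
    (hle₁ : ∀ t ∈ Ioo 0 T, D₁ t ≤ 2 * (α ^ 2 * (√(N₂ t) * √(N₁ t)) + √(N₁ t) * (c₁ * exp (g * t))))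
    (hle₂ : ∀ t ∈ Ioo 0 T, D₂ t ≤ 2 * (β ^ 2 * (√(N₁ t) * √(N₂ t)) + √(N₂ t) * (c₂ * exp (g * t))))
    (h₁ : N₁ 0 = 0) (h₂ : N₂ 0 = 0) :
    √(N₁ T) ≤ 1 / (α * β - g) * (c₁ + α * c₂ / (2 * β)) * (exp (α * β * T) - 1) := by
  have hC : 0 < cosh (α * β * T) + α / β * sinh (α * β * T) := by
    have h3 : 0 ≤ sinh (α * β * T) := Real.sinh_nonneg_iff.2 (by positivity)
    have h4 := Real.cosh_pos (α * β * T)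
    positivity
  refine le_of_forall_pos_le_add fun ε hε => ?_
  have h := coupled_gronwall_aux hT hα hβ hg hg0 hc₁ hc₂ (div_pos hε hC) hN₁ hN₂ hcont₁ hcont₂
    hd₁ hd₂ hle₁ hle₂ h₁ h₂
  rwa [div_mul_cancel₀ _ hC.ne'] at h

/-! ### Comparison of two incompressible flows -/

/-- An Euler flow `u` and a forced Euler flow `w` with the same initial velocity stay close, in terms
of the maxima of `w` and of the gradient of its vorticity, and of the `L²` norms of the forcing. -/
theorem fieldL2_difference_le {T α β g c₁ c₂ : ℝ} {u w f : ℝ → VField} {p r : ℝ → ℝ × ℝ → ℝ}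
    (hT : 0 < T) (hα : 0 < α) (hβ : 0 < β) (hg : g < α * β) (hg0 : 0 ≤ g) (hc₁ : 0 ≤ c₁)
    (hc₂ : 0 ≤ c₂)
    (hu : ContDiffOn ℝ 2 (fun q : ℝ × (ℝ × ℝ) => u q.1 q.2) (slab T))
    (hw : ContDiffOn ℝ 2 (fun q : ℝ × (ℝ × ℝ) => w q.1 q.2) (slab T))
    (hp : ∀ t ∈ Icc 0 T, ContDiff ℝ 2 (p t)) (hr : ∀ t ∈ Icc 0 T, ContDiff ℝ 2 (r t))
    (hf : ∀ t ∈ Icc 0 T, ContDiff ℝ 1 (f t))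
    (pu : ∀ t ∈ Icc 0 T, PeriodicField (u t)) (pw : ∀ t ∈ Icc 0 T, PeriodicField (w t))
    (pp : ∀ t ∈ Icc 0 T, PeriodicField (p t)) (pr : ∀ t ∈ Icc 0 T, PeriodicField (r t))
    (du : ∀ t ∈ Icc 0 T, ∀ z, divergence (u t) z = 0)
    (dw : ∀ t ∈ Icc 0 T, ∀ z, divergence (w t) z = 0)
    (mu : ∀ t ∈ Ioo 0 T, ∀ z,
      HasDerivAt (fun s => u s z) (-advect (u t) (u t) z - grad (p t) z) t)
    (mw : ∀ t ∈ Ioo 0 T, ∀ z,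
      HasDerivAt (fun s => w s z) (-advect (w t) (w t) z - grad (r t) z + f t z) t)
    (hα' : ∀ t ∈ Icc 0 T, ∀ z, vecLength (w t z) ≤ α ^ 2)
    (hβ' : ∀ t ∈ Icc 0 T, ∀ z, vecLength (grad (vorticity (w t)) z) ≤ β ^ 2)
    (hf₁ : ∀ t ∈ Icc 0 T, fieldL2 (f t) ≤ c₁ * exp (g * t))
    (hf₂ : ∀ t ∈ Icc 0 T, scalarL2 (vorticity (f t)) ≤ c₂ * exp (g * t))
    (h0 : u 0 = w 0) :
    fieldL2 (fun z => u T z - w T z)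
      ≤ 1 / (α * β - g) * (c₁ + α * c₂ / (2 * β)) * (exp (α * β * T) - 1) := by
  have su : ∀ t ∈ Icc 0 T, ContDiff ℝ 2 (u t) := fun t ht => contDiff_slice hu ht
  have sw : ∀ t ∈ Icc 0 T, ContDiff ℝ 2 (w t) := fun t ht => contDiff_slice hw ht
  have hvu := contDiffOn_vorticity hT hu
  have hvw := contDiffOn_vorticity hT hw
  have hu1 := hu.of_le (show (1 : ℕ∞ω) ≤ 2 by norm_num)
  have hw1 := hw.of_le (show (1 : ℕ∞ω) ≤ 2 by norm_num)
  set G₁ : ℝ → ℝ × ℝ → ℝ := fun t z => ((u t z).1 - (w t z).1) ^ 2 + ((u t z).2 - (w t z).2) ^ 2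
  set G₂ : ℝ → ℝ × ℝ → ℝ := fun t z => (vorticity (u t) z - vorticity (w t) z) ^ 2
  have hG₁ : ContDiffOn ℝ 1 (fun q : ℝ × (ℝ × ℝ) => G₁ q.1 q.2) (slab T) :=
    ((hu1.fst.sub hw1.fst).pow 2).add ((hu1.snd.sub hw1.snd).pow 2)
  have hG₂ : ContDiffOn ℝ 1 (fun q : ℝ × (ℝ × ℝ) => G₂ q.1 q.2) (slab T) := (hvu.sub hvw).pow 2
  have hN₁ : ∀ t, √(∫ z in cell, G₁ t z) = fieldL2 (fun z => u t z - w t z) := fun t => by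
    rw [← Real.sqrt_sq (fieldL2_nonneg fun z => u t z - w t z), fieldL2_sq]
    rfl
  have hN₂ : ∀ t, √(∫ z in cell, G₂ t z) = scalarL2 (fun z => vorticity (u t) z - vorticity (w t) z) :=
    fun t => rfl
  have hd₁ : ∀ t ∈ Ioo 0 T, HasDerivAt (fun t => ∫ z in cell, G₁ t z) (∫ z in cell,
      2 * (((u t z).1 - (w t z).1) * (-(advect (u t) (u t) z - advect (w t) (w t) z
          + grad (fun z => p t z - r t z) z) - f t z).1
        + ((u t z).2 - (w t z).2) * (-(advect (u t) (u t) z - advect (w t) (w t) z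
          + grad (fun z => p t z - r t z) z) - f t z).2)) t := by
    intro t ht
    have ht' := Ioo_subset_Icc_self ht
    refine hasDerivAt_integral_cell hG₁ ht fun z => ?_
    have hgrad : grad (fun z => p t z - r t z) z = grad (p t) z - grad (r t) z := by
      have hp1 := (hp t ht').differentiable two_ne_zero z
      have hr1 := (hr t ht').differentiable two_ne_zero z
      ext
      · exact fderiv_sub_apply' hp1 hr1 _
      · exact fderiv_sub_apply' hp1 hr1 _
    have d := (mu t ht z).sub (mw t ht z)
    have d1 := ((ContinuousLinearMap.fst ℝ ℝ ℝ).hasFDerivAt.comp_hasDerivAt t d).pow 2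
    have d2 := ((ContinuousLinearMap.snd ℝ ℝ ℝ).hasFDerivAt.comp_hasDerivAt t d).pow 2
    have d12 : HasDerivAt (fun s => G₁ s z) _ t := d1.add d2
    refine d12.congr_deriv ?_
    rw [hgrad]
    simp only [ContinuousLinearMap.coe_fst', ContinuousLinearMap.coe_snd', Function.comp_apply,
      Pi.sub_apply, Prod.fst_sub, Prod.snd_sub, Prod.fst_add, Prod.snd_add, Prod.fst_neg,
      Prod.snd_neg]
    push_cast
    ring
  have hd₂ : ∀ t ∈ Ioo 0 T, HasDerivAt (fun t => ∫ z in cell, G₂ t z) (∫ z in cell,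
      2 * ((vorticity (u t) z - vorticity (w t) z) * (-(advect (u t) (vorticity (u t)) z
        - advect (w t) (vorticity (w t)) z) - vorticity (f t) z))) t := by
    intro t ht
    have ht' := Ioo_subset_Icc_self ht
    refine hasDerivAt_integral_cell hG₂ ht fun z => ?_
    have a1 : ∀ {a : VField}, ContDiff ℝ 2 a → Differentiable ℝ (advect a a) := fun ha =>
      (contDiff_advect (m := 1) (ha.of_le (by norm_num)) ha (by norm_num)).differentiable one_ne_zero
    have a2 : ∀ {q : ℝ × ℝ → ℝ}, ContDiff ℝ 2 q → Differentiable ℝ (grad q) := fun hq =>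
      (contDiff_grad (m := 1) hq (by norm_num)).differentiable one_ne_zero
    have e1 := hasDerivAt_vorticity hu ht (mu t ht) z
    have e2 := hasDerivAt_vorticity hw ht (mw t ht) z
    have au := a1 (su t ht')
    have aw := a1 (sw t ht')
    have ap := a2 (hp t ht')
    have ar := a2 (hr t ht')
    have af := (hf t ht').differentiable one_ne_zero
    -- The curl annihilates the pressure gradient, and incompressibility removes the stretching
    -- term, so the vorticity is transported.
    rw [vorticity_sub (au z).fun_neg (ap z), vorticity_neg, vorticity_grad (hp t ht'),
      vorticity_advect_self (su t ht'), du t ht' z] at e1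
    rw [vorticity_add ((aw z).fun_neg.fun_sub (ar z)) (af z), vorticity_sub (aw z).fun_neg (ar z),
      vorticity_neg, vorticity_grad (hr t ht'), vorticity_advect_self (sw t ht'), dw t ht' z] at e2
    have e12 : HasDerivAt (fun s => G₂ s z) _ t := (e1.sub e2).pow 2
    refine e12.congr_deriv ?_
    simp only [Pi.sub_apply]
    push_cast
    ring
  have key := coupled_gronwall (N₁ := fun t => ∫ z in cell, G₁ t z)
    (N₂ := fun t => ∫ z in cell, G₂ t z) hT.le hα hβ hg hg0 hc₁ hc₂
    (fun t => integral_nonneg fun z => by positivity)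
    (fun t => integral_nonneg fun z => by positivity)
    (continuousOn_integral_cell hT.le hG₁.continuousOn)
    (continuousOn_integral_cell hT.le hG₂.continuousOn) hd₁ hd₂ ?_ ?_ ?_ ?_
  · rwa [hN₁] at key
  · intro t ht
    have ht' := Ioo_subset_Icc_self ht
    rw [hN₁, hN₂, integral_const_mul]
    refine mul_le_mul_of_nonneg_left ?_ zero_le_two
    refine (integral_momentum_difference_le (su t ht') (sw t ht')
      (((hp t ht').sub (hr t ht')).of_le (by norm_num)) (hf t ht').continuous (pu t ht') (pw t ht')
      (fun x y => by
        simp only [(pp t ht' x y).1, (pp t ht' x y).2, (pr t ht' x y).1, (pr t ht' x y).2, and_self])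
      (du t ht') (dw t ht') (hα' t ht')).trans ?_
    have := mul_le_mul_of_nonneg_left (hf₁ t ht') (fieldL2_nonneg fun z => u t z - w t z)
    linarith
  · intro t ht
    have ht' := Ioo_subset_Icc_self ht
    rw [hN₁, hN₂, integral_const_mul]
    refine mul_le_mul_of_nonneg_left ?_ zero_le_two
    have vf : Continuous (vorticity (f t)) :=
      (contDiff_vorticity (m := 0) (hf t ht') (by norm_num)).continuous
    refine (integral_vorticity_difference_le (su t ht') (sw t ht')
      (contDiff_vorticity (su t ht') (by norm_num)) (contDiff_vorticity (sw t ht') (by norm_num)) vf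
      (pu t ht') (periodicField_vorticity (pu t ht')) (periodicField_vorticity (pw t ht'))
      (du t ht') (hβ' t ht')).trans ?_
    have := mul_le_mul_of_nonneg_left (hf₂ t ht')
      (scalarL2_nonneg fun z => vorticity (u t) z - vorticity (w t) z)
    linarith
  · simp [G₁, h0]
  · simp [G₂, h0]

/-! ### Calculus of mode functions -/

lemma partialX_eq_of_hasDerivAt {f : ℝ × ℝ → ℝ} {z : ℝ × ℝ} {d : ℝ} (hf : DifferentiableAt ℝ f z)
    (h : HasDerivAt (fun x => f (x, z.2)) d z.1) : partialX f z = d := by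
  have h1 := HasFDerivAt.comp z.1 (g := f) hf.hasFDerivAt (hasFDerivAt_prodMk_left (𝕜 := ℝ) z.1 z.2)
  have h2 : HasDerivAt (fun x => f (x, z.2)) _ z.1 := h1.hasDerivAt
  rw [h.unique h2]
  simp [partialX]

lemma partialY_eq_of_hasDerivAt {f : ℝ × ℝ → ℝ} {z : ℝ × ℝ} {d : ℝ} (hf : DifferentiableAt ℝ f z)
    (h : HasDerivAt (fun y => f (z.1, y)) d z.2) : partialY f z = d := by
  have h1 := HasFDerivAt.comp z.2 (g := f) hf.hasFDerivAt (hasFDerivAt_prodMk_right (𝕜 := ℝ) z.1 z.2)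
  have h2 : HasDerivAt (fun y => f (z.1, y)) _ z.2 := h1.hasDerivAt
  rw [h.unique h2]
  simp [partialY]

section

variable {k : ℕ} {γ : ℝ} {h : ℝ → ℂ}

lemma contDiff_modeFunction {n : ℕ∞ω} (hh : ContDiff ℝ n h) :
    ContDiff ℝ n fun q : ℝ × (ℝ × ℝ) => modeFunction k γ h q.1 q.2 := by
  have ht : ContDiff ℝ n fun q : ℝ × (ℝ × ℝ) => ((q.1 : ℝ) : ℂ) := Complex.ofRealCLM.contDiff.comp contDiff_fst
  have hx : ContDiff ℝ n fun q : ℝ × (ℝ × ℝ) => ((q.2.1 : ℝ) : ℂ) :=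
    Complex.ofRealCLM.contDiff.comp contDiff_snd.fst
  have hy : ContDiff ℝ n fun q : ℝ × (ℝ × ℝ) => h q.2.2 := hh.comp contDiff_snd.snd
  exact Complex.reCLM.contDiff.comp
    (((contDiff_const.mul ht).add (contDiff_const.mul hx)).cexp.mul hy)

lemma contDiff_modeFunction_slice {n : ℕ∞ω} (hh : ContDiff ℝ n h) (t : ℝ) :
    ContDiff ℝ n (modeFunction k γ h t) :=
  (contDiff_modeFunction hh).comp (contDiff_const.prodMk contDiff_id)

lemma hasDerivAt_re_cexp_mul {c a : ℂ} {x : ℝ} (w : ℂ) :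
    HasDerivAt (fun x : ℝ => (Complex.exp (c + a * (x : ℂ)) * w).re)
      (Complex.exp (c + a * (x : ℂ)) * (a * w)).re x := by
  have h1 : HasDerivAt (fun x : ℝ => c + a * (x : ℂ)) a x := by
    simpa using ((Complex.ofRealCLM.hasDerivAt (x := x)).const_mul a).const_add c
  have h2 := (h1.cexp.mul_const w)
  have h3 := Complex.reCLM.hasFDerivAt.comp_hasDerivAt x h2
  refine HasDerivAt.congr_deriv h3 ?_
  simp only [Complex.reCLM_apply]
  congr 1
  ring

lemma hasDerivAt_modeFunction (t : ℝ) (z : ℝ × ℝ) :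
    HasDerivAt (fun s => modeFunction k γ h s z) (modeFunction k γ (fun y => γ * h y) t z) t := by
  have h1 := hasDerivAt_re_cexp_mul (c := Complex.I * k * z.1) (a := (γ : ℂ)) (x := t) (h z.2)
  unfold modeFunction
  simpa only [add_comm] using h1

lemma partialX_modeFunction (hh : ContDiff ℝ 1 h) (t : ℝ) :
    partialX (modeFunction k γ h t) = modeFunction k γ (fun y => Complex.I * k * h y) t := by
  ext z
  exact partialX_eq_of_hasDerivAt ((contDiff_modeFunction_slice hh t).differentiable one_ne_zero z)
    (hasDerivAt_re_cexp_mul (c := γ * t) (a := Complex.I * k) (x := z.1) (h z.2))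

lemma partialY_modeFunction (hh : ContDiff ℝ 1 h) (t : ℝ) :
    partialY (modeFunction k γ h t) = modeFunction k γ (deriv h) t := by
  ext z
  refine partialY_eq_of_hasDerivAt
    ((contDiff_modeFunction_slice hh t).differentiable one_ne_zero z) ?_
  have h1 := (((hh.differentiable one_ne_zero) z.2).hasDerivAt).const_mul
    (Complex.exp ((γ : ℂ) * (t : ℂ) + Complex.I * (k : ℂ) * (z.1 : ℂ)))
  exact Complex.reCLM.hasFDerivAt.comp_hasDerivAt z.2 h1

lemma modeFunction_neg (t : ℝ) (z : ℝ × ℝ) :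
    modeFunction k γ (fun y => -h y) t z = -modeFunction k γ h t z := by
  simp [modeFunction]

lemma modeFunction_add (h' : ℝ → ℂ) (t : ℝ) (z : ℝ × ℝ) :
    modeFunction k γ (fun y => h y + h' y) t z = modeFunction k γ h t z + modeFunction k γ h' t z := by
  simp only [modeFunction, mul_add, Complex.add_re]

lemma periodicField_modeFunction (hh : Function.Periodic h (2 * π)) (t : ℝ) :
    PeriodicField (modeFunction k γ h t) := by
  intro x y
  constructor
  · have h1 : (γ : ℂ) * t + Complex.I * k * ((x + 2 * π : ℝ) : ℂ)
        = γ * t + Complex.I * k * x + k * (2 * π * Complex.I) := by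
      push_cast; ring
    simp only [modeFunction]
    rw [h1, Complex.exp_add, Complex.exp_nat_mul_two_pi_mul_I, mul_one]
  · simp only [modeFunction, hh y]

lemma abs_modeFunction_le (t : ℝ) (z : ℝ × ℝ) :
    |modeFunction k γ h t z| ≤ exp (γ * t) * ‖h z.2‖ := by
  refine (Complex.abs_re_le_norm _).trans_eq ?_
  rw [norm_mul, Complex.norm_exp]
  simp

lemma periodic_deriv {c : ℝ} (hh : Function.Periodic h c) : Function.Periodic (deriv h) c := by
  intro x
  have h1 : (fun x => h (x + c)) = h := funext hh
  rw [← deriv_comp_add_const, h1]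

/-- The alternative `h = 0` is carried along because a vanishing profile satisfies the equations for
every rate, so nothing forces `γ ≤ Γ` for it. -/
lemma exists_modeFunction_bound {Γ : ℝ} (hc : Continuous h) (hh : Function.Periodic h (2 * π))
    (hΓ : γ ≤ Γ ∨ ∀ y, h y = 0) :
    ∃ C, 0 < C ∧ ∀ t, 0 ≤ t → ∀ z, |modeFunction k γ h t z| ≤ C * exp (Γ * t) := by
  obtain ⟨C, hC0, hC⟩ := (hh.isBounded_of_continuous (by positivity) hc).exists_pos_norm_le
  refine ⟨C, hC0, fun t ht z => ?_⟩
  rcases hΓ with hΓ | h0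
  · refine (abs_modeFunction_le t z).trans ?_
    rw [mul_comm]
    gcongr
    exact hC _ (mem_range_self _)
  · simp only [modeFunction, h0, mul_zero, Complex.zero_re, abs_zero]
    positivity

end

/-! ### The velocity of a mode -/

section

variable {k : ℕ} {γ : ℝ} {χ : ℝ → ℂ}

lemma contDiff_deriv_of_smooth {h : ℝ → ℂ} (hh : ContDiff ℝ ∞ h) : ContDiff ℝ ∞ (deriv h) :=
  (contDiff_infty_iff_deriv.1 hh).2

lemma modeVelocity_eq (hχ : ContDiff ℝ ∞ χ) (t : ℝ) :
    modeVelocity k γ χ t = fun z =>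
      (modeFunction k γ (fun y => -deriv χ y) t z, modeFunction k γ (fun y => Complex.I * k * χ y) t z) := by
  have h1 : ContDiff ℝ 1 χ := hχ.of_le (by norm_num)
  ext z
  · simp only [modeVelocity, partialY_modeFunction h1, modeFunction_neg]
  · simp only [modeVelocity, partialX_modeFunction h1]

lemma contDiff_modeVelocity (hχ : ContDiff ℝ ∞ χ) :
    ContDiff ℝ ∞ fun q : ℝ × (ℝ × ℝ) => modeVelocity k γ χ q.1 q.2 := by
  simp only [fun t => modeVelocity_eq (k := k) (γ := γ) hχ t]
  exact (contDiff_modeFunction (contDiff_deriv_of_smooth hχ).neg).prodMk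
    (contDiff_modeFunction (contDiff_const.mul hχ))

lemma contDiff_modeVelocity_slice (hχ : ContDiff ℝ ∞ χ) (t : ℝ) :
    ContDiff ℝ ∞ (modeVelocity k γ χ t) := by
  rw [modeVelocity_eq hχ]
  exact (contDiff_modeFunction_slice (contDiff_deriv_of_smooth hχ).neg t).prodMk
    (contDiff_modeFunction_slice (contDiff_const.mul hχ) t)

lemma periodicField_modeVelocity (hχ : ContDiff ℝ ∞ χ) (hp : Function.Periodic χ (2 * π)) (t : ℝ) :
    PeriodicField (modeVelocity k γ χ t) := by
  rw [modeVelocity_eq hχ]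
  have p1 := periodicField_modeFunction (k := k) (γ := γ) (h := fun y => -deriv χ y)
    (fun y => by simp only [periodic_deriv hp y]) t
  have p2 := periodicField_modeFunction (k := k) (γ := γ) (h := fun y => Complex.I * k * χ y)
    (fun y => by simp only [hp y]) t
  exact fun x y => ⟨Prod.ext (p1 x y).1 (p2 x y).1, Prod.ext (p1 x y).2 (p2 x y).2⟩

lemma vorticity_modeVelocity (hχ : ContDiff ℝ ∞ χ) (t : ℝ) :
    vorticity (modeVelocity k γ χ t)
      = modeFunction k γ (fun y => deriv (deriv χ) y + -((k : ℂ) ^ 2 * χ y)) t := by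
  have h1 := contDiff_deriv_of_smooth hχ
  have h2 : ContDiff ℝ 1 (fun y => -deriv χ y) := h1.neg.of_le (by norm_num)
  have h3 : ContDiff ℝ 1 (fun y => Complex.I * k * χ y) := (contDiff_const.mul hχ).of_le (by norm_num)
  have hd := (contDiff_modeVelocity_slice (k := k) (γ := γ) hχ t).differentiable (by norm_num)
  ext z
  rw [vorticity_eq (hd z), modeVelocity_eq hχ]
  simp only
  rw [partialX_modeFunction h3, partialY_modeFunction h2, modeFunction_add, sub_eq_neg_add,
    ← modeFunction_neg]
  congr 2
  · ext y
    rw [deriv.fun_neg, neg_neg]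
  · ext y
    linear_combination (k : ℂ) ^ 2 * χ y * Complex.I_sq

end

/-! ### The linearized flow -/

lemma two_le_infty : (2 : ℕ∞ω) ≤ ∞ := WithTop.coe_le_coe.2 (le_top (a := (2 : ℕ∞)))

section

variable {U₀ : ℝ} {m k : ℕ} {γ : ℝ} {χ ϖ : ℝ → ℂ}

lemma contDiff_shearFlow {n : ℕ∞ω} : ContDiff ℝ n (shearFlow U₀ m) := by
  unfold shearFlow
  fun_prop

lemma hasDerivAt_shear (y : ℝ) :
    HasDerivAt (fun y => U₀ * sin (m * y)) (U₀ * m * cos (m * y)) y := by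
  have h1 : HasDerivAt (fun y : ℝ => (m : ℝ) * y) m y := by
    simpa using (hasDerivAt_id y).const_mul (m : ℝ)
  refine (h1.sin.const_mul U₀).congr_deriv (by ring)

lemma partialX_shear (z : ℝ × ℝ) : partialX (fun z : ℝ × ℝ => U₀ * sin (m * z.2)) z = 0 :=
  partialX_eq_of_hasDerivAt (by fun_prop) (hasDerivAt_const z.1 (U₀ * sin (m * z.2)))

lemma partialY_shear (z : ℝ × ℝ) :
    partialY (fun z : ℝ × ℝ => U₀ * sin (m * z.2)) z = U₀ * m * cos (m * z.2) :=
  partialY_eq_of_hasDerivAt (by fun_prop) (hasDerivAt_shear _)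

lemma partialX_zero (z : ℝ × ℝ) : partialX (fun _ : ℝ × ℝ => (0 : ℝ)) z = 0 := by simp [partialX]

lemma partialY_zero (z : ℝ × ℝ) : partialY (fun _ : ℝ × ℝ => (0 : ℝ)) z = 0 := by simp [partialY]

lemma differentiableAt_shearFlow (z : ℝ × ℝ) : DifferentiableAt ℝ (shearFlow U₀ m) z :=
  (contDiff_shearFlow (n := 1)).differentiable one_ne_zero z

lemma divergence_shearFlow (z : ℝ × ℝ) : divergence (shearFlow U₀ m) z = 0 := by
  rw [divergence_eq (differentiableAt_shearFlow z)]
  simp only [shearFlow, partialX_shear, partialY_zero, add_zero]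

lemma vorticity_shearFlow (z : ℝ × ℝ) :
    vorticity (shearFlow U₀ m) z = -(U₀ * m * cos (m * z.2)) := by
  rw [vorticity_eq (differentiableAt_shearFlow z)]
  simp only [shearFlow, partialX_zero, partialY_shear, zero_sub]

lemma advect_shearFlow_self (z : ℝ × ℝ) : advect (shearFlow U₀ m) (shearFlow U₀ m) z = 0 := by
  rw [advect_field_eq (differentiableAt_shearFlow z)]
  simp only [shearFlow, partialX_shear, partialX_zero, partialY_zero]
  simp

lemma periodicField_shearFlow : PeriodicField (shearFlow U₀ m) := by
  intro x y
  refine ⟨rfl, ?_⟩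
  simp only [shearFlow, mul_add, Real.sin_add_nat_mul_two_pi]

lemma contDiff_linearizedFlow (hχ : ContDiff ℝ ∞ χ) (ε : ℝ) :
    ContDiff ℝ ∞ fun q : ℝ × (ℝ × ℝ) => linearizedFlow U₀ m k γ χ ε q.1 q.2 :=
  (contDiff_shearFlow.comp contDiff_snd).add ((contDiff_modeVelocity hχ).const_smul ε)

lemma differentiableAt_modeVelocity (hχ : ContDiff ℝ ∞ χ) (t : ℝ) (z : ℝ × ℝ) :
    DifferentiableAt ℝ (modeVelocity k γ χ t) z :=
  (contDiff_modeVelocity_slice hχ t).differentiable (by norm_num) z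

lemma periodicField_linearizedFlow (hχ : ContDiff ℝ ∞ χ) (hp : Function.Periodic χ (2 * π))
    (ε t : ℝ) : PeriodicField (linearizedFlow U₀ m k γ χ ε t) := by
  intro x y
  have h1 := periodicField_shearFlow (U₀ := U₀) (m := m) x y
  have h2 := periodicField_modeVelocity (k := k) (γ := γ) hχ hp t x y
  simp only [linearizedFlow, h1.1, h1.2, h2.1, h2.2, and_self]

lemma fderiv_linearizedFlow (hχ : ContDiff ℝ ∞ χ) (ε t : ℝ) (z e : ℝ × ℝ) :
    fderiv ℝ (linearizedFlow U₀ m k γ χ ε t) z e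
      = fderiv ℝ (shearFlow U₀ m) z e + ε • fderiv ℝ (modeVelocity k γ χ t) z e := by
  unfold linearizedFlow
  rw [fderiv_fun_add (differentiableAt_shearFlow z)
    ((differentiableAt_modeVelocity hχ t z).fun_const_smul ε),
    fderiv_fun_const_smul (differentiableAt_modeVelocity hχ t z)]
  rfl

lemma divergence_linearizedFlow (hχ : ContDiff ℝ ∞ χ) (ε t : ℝ) (z : ℝ × ℝ)
    (hd : divergence (modeVelocity k γ χ t) z = 0) :
    divergence (linearizedFlow U₀ m k γ χ ε t) z = 0 := by
  have h0 := divergence_shearFlow (U₀ := U₀) (m := m) z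
  simp only [divergence, partialX, partialY, fderiv_linearizedFlow hχ, Prod.fst_add, Prod.snd_add,
    Prod.smul_fst, Prod.smul_snd, smul_eq_mul] at *
  linear_combination h0 + ε * hd

lemma vorticity_linearizedFlow (hχ : ContDiff ℝ ∞ χ) (ε t : ℝ) (z : ℝ × ℝ) :
    vorticity (linearizedFlow U₀ m k γ χ ε t) z
      = -(U₀ * m * cos (m * z.2)) + ε * vorticity (modeVelocity k γ χ t) z := by
  rw [← vorticity_shearFlow]
  simp only [vorticity, partialX, partialY, fderiv_linearizedFlow hχ, Prod.fst_add, Prod.snd_add,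
    Prod.smul_fst, Prod.smul_snd, smul_eq_mul]
  ring

/-- The linearized flow solves the Euler equations up to the quadratic term `ε² (ṽ · ∇) ṽ`. -/
lemma hasDerivAt_linearizedFlow (hmode : IsGrowingMode U₀ m k γ χ ϖ) (ε t : ℝ) (z : ℝ × ℝ) :
    HasDerivAt (fun s => linearizedFlow U₀ m k γ χ ε s z)
      (-advect (linearizedFlow U₀ m k γ χ ε t) (linearizedFlow U₀ m k γ χ ε t) z
        - grad (fun z => ε * modeFunction k γ ϖ t z) z
        + ε ^ 2 • advect (modeVelocity k γ χ t) (modeVelocity k γ χ t) z) t := by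
  refine (((hmode.linearized.momentum t z).const_smul ε).const_add (shearFlow U₀ m z)).congr_deriv ?_
  have hϖ : DifferentiableAt ℝ (modeFunction k γ ϖ t) z :=
    (contDiff_modeFunction_slice hmode.pressure_smooth t).differentiable (by norm_num) z
  have hgrad : grad (fun z => ε * modeFunction k γ ϖ t z) z = ε • grad (modeFunction k γ ϖ t) z := by
    have h : ∀ e, fderiv ℝ (fun z => ε * modeFunction k γ ϖ t z) z e
        = ε * fderiv ℝ (modeFunction k γ ϖ t) z e := by
      intro e
      rw [fderiv_const_mul hϖ]
      rfl
    ext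
    · exact h _
    · exact h _
  have h0 := advect_shearFlow_self (U₀ := U₀) (m := m) z
  rw [hgrad]
  simp only [advect, partialX, partialY, fderiv_linearizedFlow hmode.smooth] at *
  simp only [linearizedFlow, Prod.fst_add, Prod.snd_add, Prod.smul_fst, Prod.smul_snd, smul_eq_mul]
  -- The terms of order one in `ε` agree; `h0` removes the self-advection of the shear flow, and the
  -- forcing cancels the term of order `ε²`.
  linear_combination (norm := module) h0

lemma fieldL2_const_smul {c : ℝ} (hc : 0 ≤ c) (f : VField) :
    fieldL2 (fun z => c • f z) = c * fieldL2 f := by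
  have h : ∀ z, (c • f z).1 ^ 2 + (c • f z).2 ^ 2 = c ^ 2 * ((f z).1 ^ 2 + (f z).2 ^ 2) := fun z => by
    simp only [Prod.smul_fst, Prod.smul_snd, smul_eq_mul]; ring
  rw [← sq_eq_sq₀ (fieldL2_nonneg _) (mul_nonneg hc (fieldL2_nonneg _)), mul_pow, fieldL2_sq,
    fieldL2_sq, ← integral_const_mul]
  simp only [h]

lemma scalarL2_const_mul {c : ℝ} (hc : 0 ≤ c) (f : ℝ × ℝ → ℝ) :
    scalarL2 (fun z => c * f z) = c * scalarL2 f := by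
  rw [← sq_eq_sq₀ (scalarL2_nonneg _) (mul_nonneg hc (scalarL2_nonneg _)), mul_pow, scalarL2_sq,
    scalarL2_sq, ← integral_const_mul]
  simp only [mul_pow]

lemma gammaU_pos (hU₀ : 0 < U₀) (hk : 1 ≤ k) (hkm : k < m) : 0 < gammaU U₀ m k := by
  have hk' : (0 : ℝ) < k := by exact_mod_cast hk
  have hkm' : (k : ℝ) < m := by exact_mod_cast hkm
  have h1 : (0 : ℝ) < (m : ℝ) ^ 2 - (k : ℝ) ^ 2 := by nlinarith
  unfold gammaU
  positivity

/-- The nonlinear solution stays close to the linearized one. -/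
theorem fieldL2_sub_linearizedFlow_le (hΓ : 0 ≤ gammaU U₀ m k)
    (hmode : IsGrowingMode U₀ m k γ χ ϖ) {α β b₁ b₂ : ℝ}
    (hadm : AdmissibleConstants U₀ m k γ χ α β b₁ b₂) {ε : ℝ} (hε : 0 < ε) (hε1 : ε < 1)
    {T : ℝ} {u : ℝ → VField} {P : ℝ → ℝ × ℝ → ℝ} (hu : IsEulerSolution T u P)
    (h0 : u 0 = linearizedFlow U₀ m k γ χ ε 0) {t : ℝ} (ht : 0 < t) (htT : t ≤ T)
    (hte : t ≤ finalTime U₀ m k ε) :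
    fieldL2 (fun z => u t z - linearizedFlow U₀ m k γ χ ε t z)
      ≤ ε ^ 2 * (1 / (α * β - 2 * gammaU U₀ m k) * (b₁ + α * b₂ / (2 * β)))
        * (exp (α * β * t) - 1) := by
  have hsub : Icc 0 t ⊆ Icc 0 T := Icc_subset_Icc_right htT
  have hsub' : Icc 0 t ⊆ Icc 0 (finalTime U₀ m k ε) := Icc_subset_Icc_right hte
  have hmem : ε ∈ Ioo (0 : ℝ) 1 := ⟨hε, hε1⟩
  have hv2 : ∀ s, ContDiff ℝ 2 (modeVelocity k γ χ s) := fun s =>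
    (contDiff_modeVelocity_slice hmode.smooth s).of_le two_le_infty
  have hadv : ∀ s, ContDiff ℝ 1 (advect (modeVelocity k γ χ s) (modeVelocity k γ χ s)) := fun s =>
    contDiff_advect ((hv2 s).of_le (by norm_num)) (hv2 s) (by norm_num)
  have key := fieldL2_difference_le (T := t) (α := α) (β := β) (g := 2 * gammaU U₀ m k)
    (c₁ := ε ^ 2 * b₁) (c₂ := ε ^ 2 * b₂) (u := u) (w := linearizedFlow U₀ m k γ χ ε)
    (f := fun s z => ε ^ 2 • advect (modeVelocity k γ χ s) (modeVelocity k γ χ s) z)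
    (p := P) (r := fun s z => ε * modeFunction k γ ϖ s z)
    ht hadm.alpha_pos hadm.beta_pos hadm.rate (by positivity)
    (mul_nonneg (sq_nonneg ε) hadm.b₁_pos.le) (mul_nonneg (sq_nonneg ε) hadm.b₂_pos.le)
    (hu.regular.mono (prod_mono hsub subset_rfl))
    ((contDiff_linearizedFlow hmode.smooth ε).of_le two_le_infty).contDiffOn
    (fun s hs => hu.pressure_regular s (hsub hs))
    (fun s _ => contDiff_const.mul
      ((contDiff_modeFunction_slice hmode.pressure_smooth s).of_le two_le_infty))
    (fun s _ => (hadv s).const_smul (ε ^ 2))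
    (fun s hs => hu.periodic s (hsub hs))
    (fun s _ => periodicField_linearizedFlow hmode.smooth hmode.periodic ε s)
    (fun s hs => hu.pressure_periodic s (hsub hs))
    (fun s _ x y => by
      have h := periodicField_modeFunction (k := k) (γ := γ) hmode.pressure_periodic s x y
      simp only [h.1, h.2, and_self])
    (fun s hs => hu.incompressible s (hsub hs))
    (fun s _ z => divergence_linearizedFlow hmode.smooth ε s z (hmode.linearized.incompressible s z))
    (fun s hs z => (hu.momentum s (hsub (Ioo_subset_Icc_self hs)) z).hasDerivAt
      (Icc_mem_nhds hs.1 (hs.2.trans_le htT)))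
    (fun s _ z => hasDerivAt_linearizedFlow hmode ε s z)
    (fun s hs => hadm.velocity_bound ε hmem s (hsub' hs))
    (fun s hs => hadm.vorticity_bound ε hmem s (hsub' hs))
    (fun s hs => by
      rw [fieldL2_const_smul (sq_nonneg ε), mul_assoc]
      exact mul_le_mul_of_nonneg_left (hadm.velocity_forcing s hs.1) (sq_nonneg ε))
    (fun s hs => by
      -- As `ṽ` is divergence-free, the curl of the forcing is `ε² ṽ · ∇ω_ṽ`, the quantity that `b₂`
      -- controls.
      have h : vorticity (fun z => ε ^ 2 • advect (modeVelocity k γ χ s) (modeVelocity k γ χ s) z)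
          = fun z => ε ^ 2 * advect (modeVelocity k γ χ s) (vorticity (modeVelocity k γ χ s)) z := by
        ext z
        rw [vorticity_const_smul _ ((hadv s).differentiable one_ne_zero z),
          vorticity_advect_self (hv2 s), hmode.linearized.incompressible s z, zero_mul, add_zero]
      rw [h, scalarL2_const_mul (sq_nonneg ε), mul_assoc]
      exact mul_le_mul_of_nonneg_left (hadm.vorticity_forcing s hs.1) (sq_nonneg ε))
    h0
  refine key.trans_eq ?_
  ring

/-! ### Existence of admissible constants -/

/-- All components of the mode velocity, of its gradient and of its vorticity gradient are mode
functions of smooth periodic profiles, hence at most `C e^{Γt}` with one common constant `C`. -/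
theorem exists_admissibleConstants (hU₀ : 0 < U₀) (hΓ : 0 < gammaU U₀ m k)
    (hχ : ContDiff ℝ ∞ χ) (hp : Function.Periodic χ (2 * π))
    (hγ : γ ≤ gammaU U₀ m k ∨ ∀ y, χ y = 0) :
    ∃ α β b₁ b₂ : ℝ, AdmissibleConstants U₀ m k γ χ α β b₁ b₂ := by
  set Γ := gammaU U₀ m k
  -- The vorticity profile of the mode.
  set ζ : ℝ → ℂ := fun y => deriv (deriv χ) y + -((k : ℂ) ^ 2 * χ y) with hζ
  have s1 := contDiff_deriv_of_smooth hχ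
  have s2 := contDiff_deriv_of_smooth s1
  have sζ : ContDiff ℝ ∞ ζ := s2.add (contDiff_const.mul hχ).neg
  have p1 := periodic_deriv hp
  have p2 := periodic_deriv p1
  have pζ : Function.Periodic ζ (2 * π) := fun y => by simp only [hζ, hp y, p2 y]
  have z1 : γ ≤ Γ ∨ ∀ y, deriv χ y = 0 := hγ.imp_right fun h y => by
    rw [show χ = fun _ => 0 from funext h, deriv_const]
  have z2 : γ ≤ Γ ∨ ∀ y, deriv (deriv χ) y = 0 := z1.imp_right fun h y => by
    rw [show deriv χ = fun _ => 0 from funext h, deriv_const]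
  have zζ : γ ≤ Γ ∨ ∀ y, ζ y = 0 := by
    rcases hγ with h | h
    · exact Or.inl h
    · refine z2.imp_right fun h2 y => ?_
      simp [hζ, h, h2]
  have zζ' : γ ≤ Γ ∨ ∀ y, deriv ζ y = 0 := zζ.imp_right fun h y => by
    rw [show ζ = fun _ => 0 from funext h, deriv_const]
  have bound : ∀ h : ℝ → ℂ, ContDiff ℝ ∞ h → Function.Periodic h (2 * π) →
      (γ ≤ Γ ∨ ∀ y, h y = 0) →
      ∃ C, 0 < C ∧ ∀ t, 0 ≤ t → ∀ z, |modeFunction k γ h t z| ≤ C * exp (Γ * t) :=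
    fun h hs hp hz => exists_modeFunction_bound hs.continuous hp hz
  have ik : ∀ h : ℝ → ℂ, ContDiff ℝ ∞ h → Function.Periodic h (2 * π) →
      (γ ≤ Γ ∨ ∀ y, h y = 0) → ∃ C, 0 < C ∧ ∀ t, 0 ≤ t → ∀ z,
        |modeFunction k γ (fun y => Complex.I * k * h y) t z| ≤ C * exp (Γ * t) :=
    fun h hs hp hz => bound _ (contDiff_const.mul hs) (fun y => by simp only [hp y])
      (hz.imp_right fun h y => by simp [h y])
  obtain ⟨C1, hC1, B1⟩ := bound _ s1 p1 z1
  obtain ⟨C2, hC2, B2⟩ := ik _ hχ hp hγ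
  obtain ⟨C3, hC3, B3⟩ := bound _ s2 p2 z2
  obtain ⟨C4, hC4, B4⟩ := ik _ s1 p1 z1
  obtain ⟨C5, hC5, B5⟩ := ik (fun y => Complex.I * k * χ y) (contDiff_const.mul hχ)
    (fun y => by simp only [hp y]) (hγ.imp_right fun h y => by simp [h y])
  obtain ⟨C6, hC6, B6⟩ := bound _ (contDiff_deriv_of_smooth sζ) (periodic_deriv pζ) zζ'
  obtain ⟨C7, hC7, B7⟩ := ik _ sζ pζ zζ
  obtain ⟨C9, hC9, B9⟩ := bound (deriv fun y => Complex.I * k * χ y)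
    (contDiff_deriv_of_smooth (contDiff_const.mul hχ))
    (periodic_deriv fun y => by simp only [hp y]) (hγ.imp_right fun h y => by simp [h])
  set C := C1 + C2 + C3 + C4 + C5 + C6 + C7 + C9 with hCdef
  have hC : 0 < C := by positivity
  have weaken : ∀ {c x t : ℝ}, x ≤ c * exp (Γ * t) → c ≤ C → x ≤ C * exp (Γ * t) :=
    fun h hc => h.trans (mul_le_mul_of_nonneg_right hc (exp_pos _).le)
  -- The final time is exactly where `ε e^{Γt}` reaches `1`; this makes the bounds uniform in `ε`.
  have hsmall : ∀ ε ∈ Ioo (0 : ℝ) 1, ∀ t ∈ Icc 0 (finalTime U₀ m k ε), ∀ x : ℝ,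
      |x| ≤ C * exp (Γ * t) → |ε * x| ≤ C := by
    intro ε hε t ht x hx
    have h1 : Γ * t ≤ log (1 / ε) := by
      have h2 := mul_le_mul_of_nonneg_left ht.2 hΓ.le
      rwa [finalTime, mul_inv_cancel_left₀ hΓ.ne'] at h2
    have h3 : exp (Γ * t) ≤ 1 / ε := (exp_le_exp.2 h1).trans_eq (exp_log (one_div_pos.2 hε.1))
    rw [abs_mul, abs_of_pos hε.1]
    calc ε * |x| ≤ ε * (C * (1 / ε)) := by gcongr; exacts [hε.1.le, hx.trans (by gcongr)]
      _ = C := by field_simp [hε.1.ne']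
  have v1 : ∀ t z, (modeVelocity k γ χ t z).1 = -modeFunction k γ (deriv χ) t z := fun t z => by
    rw [modeVelocity_eq hχ]
    exact modeFunction_neg t z
  have v2 : ∀ t z, (modeVelocity k γ χ t z).2 = modeFunction k γ (fun y => Complex.I * k * χ y) t z :=
    fun t z => by rw [modeVelocity_eq hχ]
  have smooth1 : ∀ {h : ℝ → ℂ}, ContDiff ℝ ∞ h → ContDiff ℝ 1 h := fun h => h.of_le (by norm_num)
  have hv1 : ∀ t ≥ 0, ∀ z, |(modeVelocity k γ χ t z).1| ≤ C * exp (Γ * t) := fun t ht z => by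
    rw [v1, abs_neg]
    exact weaken (B1 t ht z) (by linarith)
  have hv2 : ∀ t ≥ 0, ∀ z, |(modeVelocity k γ χ t z).2| ≤ C * exp (Γ * t) := fun t ht z => by
    rw [v2]
    exact weaken (B2 t ht z) (by linarith)
  have quad : ∀ {a b c d X : ℝ}, 0 ≤ X → |a| ≤ X → |b| ≤ X → |c| ≤ X → |d| ≤ X →
      |a * b + c * d| ≤ 2 * X ^ 2 := by
    intro a b c d X hX ha hb hc hd
    refine (abs_add_le _ _).trans ?_
    rw [abs_mul, abs_mul]
    have e1 := mul_le_mul ha hb (abs_nonneg _) hX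
    have e2 := mul_le_mul hc hd (abs_nonneg _) hX
    linarith
  have hXsq : ∀ t, (C * exp (Γ * t)) ^ 2 = C ^ 2 * exp (2 * Γ * t) := fun t => by
    rw [mul_pow, ← exp_nat_mul]
    congr 2
    push_cast
    ring
  set A := U₀ + 2 * C
  set D := U₀ * m ^ 2 + 2 * C
  have hA : 0 ≤ A := by positivity
  have hD : 0 ≤ D := by positivity
  -- `A` and `D` bound the velocity and the vorticity gradient. The summands `1` give `α² ≥ α ≥ A`
  -- and `β² ≥ β ≥ D`, and `αβ ≥ α > 2Γ`. Each advected component is at most `2 (C e^{Γt})²`, there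
  -- are two of them for the velocity and one for the vorticity, and `2π` passes from the maximum to
  -- the `L²` norm.
  refine ⟨1 + A + 2 * Γ, 1 + D, 2 * π * (4 * C ^ 2), 2 * π * (2 * C ^ 2), ?_⟩
  constructor
  · positivity
  · positivity
  · positivity
  · positivity
  · nlinarith
  · intro ε hε t ht z
    have h1 := hsmall ε hε t ht _ (hv1 t ht.1 z)
    have h2 := hsmall ε hε t ht _ (hv2 t ht.1 z)
    have h3 : |U₀ * sin (m * z.2)| ≤ U₀ := by
      rw [abs_mul, abs_of_pos hU₀]
      exact mul_le_of_le_one_right hU₀.le (abs_sin_le_one _)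
    have h4 : vecLength (linearizedFlow U₀ m k γ χ ε t z) ≤ A := by
      refine (vecLength_le_add _).trans ?_
      simp only [linearizedFlow, shearFlow, Prod.fst_add, Prod.snd_add, Prod.smul_fst,
        Prod.smul_snd, smul_eq_mul, zero_add]
      linarith [abs_add_le (U₀ * sin (m * z.2)) (ε * (modeVelocity k γ χ t z).1)]
    nlinarith
  · intro ε hε t ht z
    have hvort : vorticity (linearizedFlow U₀ m k γ χ ε t)
        = fun z => -(U₀ * m * cos (m * z.2)) + ε * modeFunction k γ ζ t z := by
      ext z
      rw [vorticity_linearizedFlow hχ, vorticity_modeVelocity hχ]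
    have hdm : DifferentiableAt ℝ (modeFunction k γ ζ t) z :=
      (contDiff_modeFunction_slice (smooth1 sζ) t).differentiable one_ne_zero z
    have hsplit : ∀ e, fderiv ℝ (fun z : ℝ × ℝ => -(U₀ * m * cos (m * z.2)) + ε * modeFunction k γ ζ t z) z e
        = fderiv ℝ (fun z : ℝ × ℝ => -(U₀ * m * cos (m * z.2))) z e
          + ε * fderiv ℝ (modeFunction k γ ζ t) z e := by
      intro e
      rw [fderiv_add_apply' (by fun_prop) (hdm.const_mul ε), fderiv_const_mul hdm]
      rfl
    have hX : partialX (fun z : ℝ × ℝ => -(U₀ * m * cos (m * z.2))) z = 0 :=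
      partialX_eq_of_hasDerivAt (by fun_prop) (hasDerivAt_const z.1 (-(U₀ * m * cos (m * z.2))))
    have hY : partialY (fun z : ℝ × ℝ => -(U₀ * m * cos (m * z.2))) z
        = U₀ * m ^ 2 * sin (m * z.2) := by
      refine partialY_eq_of_hasDerivAt (by fun_prop) ?_
      have h1 : HasDerivAt (fun y : ℝ => (m : ℝ) * y) m z.2 := by
        simpa using (hasDerivAt_id z.2).const_mul (m : ℝ)
      exact (h1.cos.const_mul (U₀ * m)).neg.congr_deriv (by ring)
    have hgX : (grad (vorticity (linearizedFlow U₀ m k γ χ ε t)) z).1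
        = ε * modeFunction k γ (fun y => Complex.I * k * ζ y) t z := by
      rw [← partialX_modeFunction (smooth1 sζ), hvort, grad]
      unfold partialX at *
      rw [hsplit, hX, zero_add]
    have hgY : (grad (vorticity (linearizedFlow U₀ m k γ χ ε t)) z).2
        = U₀ * m ^ 2 * sin (m * z.2) + ε * modeFunction k γ (deriv ζ) t z := by
      rw [← partialY_modeFunction (smooth1 sζ), hvort, grad]
      unfold partialY at *
      rw [hsplit, hY]
    have h1 := hsmall ε hε t ht _ (weaken (B7 t ht.1 z) (by linarith))
    have h2 := hsmall ε hε t ht _ (weaken (B6 t ht.1 z) (by linarith))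
    have h3 : |U₀ * m ^ 2 * sin (m * z.2)| ≤ U₀ * m ^ 2 := by
      rw [abs_mul, abs_of_nonneg (by positivity : 0 ≤ U₀ * (m : ℝ) ^ 2)]
      exact mul_le_of_le_one_right (by positivity) (abs_sin_le_one _)
    have h4 : vecLength (grad (vorticity (linearizedFlow U₀ m k γ χ ε t)) z) ≤ D := by
      refine (vecLength_le_add _).trans ?_
      rw [hgX, hgY]
      linarith [abs_add_le (U₀ * m ^ 2 * sin (m * z.2)) (ε * modeFunction k γ (deriv ζ) t z)]
    nlinarith
  · intro t ht
    have hX0 : 0 ≤ C * exp (Γ * t) := by positivity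
    have hb : ∀ z, |vecLength (advect (modeVelocity k γ χ t) (modeVelocity k γ χ t) z)|
        ≤ 4 * C ^ 2 * exp (2 * Γ * t) := by
      intro z
      rw [abs_of_nonneg (vecLength_nonneg _)]
      refine (vecLength_le_add _).trans ?_
      have f1 : (fun z => (modeVelocity k γ χ t z).1) = modeFunction k γ (fun y => -deriv χ y) t := by
        rw [modeVelocity_eq hχ]
      have f2 : (fun z => (modeVelocity k γ χ t z).2)
          = modeFunction k γ (fun y => Complex.I * k * χ y) t := by rw [modeVelocity_eq hχ]
      rw [advect_field_eq (differentiableAt_modeVelocity hχ t z), f1, f2,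
        partialX_modeFunction (smooth1 s1.neg), partialY_modeFunction (smooth1 s1.neg),
        partialX_modeFunction (smooth1 (contDiff_const.mul hχ)),
        partialY_modeFunction (smooth1 (contDiff_const.mul hχ))]
      have g1 : modeFunction k γ (fun y => Complex.I * k * -deriv χ y) t z
          = -modeFunction k γ (fun y => Complex.I * k * deriv χ y) t z := by
        rw [← modeFunction_neg]
        simp only [mul_neg]
      have g2 : modeFunction k γ (deriv fun y => -deriv χ y) t z
          = -modeFunction k γ (deriv (deriv χ)) t z := by
        rw [← modeFunction_neg]
        congr 1
        ext y
        rw [deriv.fun_neg]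
      have q1 := quad hX0 (hv1 t ht z)
        ((abs_neg _).trans_le (weaken (B4 t ht z) (by linarith))) (hv2 t ht z)
        ((abs_neg _).trans_le (weaken (B3 t ht z) (by linarith)))
      rw [← g1, ← g2] at q1
      have q2 := quad hX0 (hv1 t ht z) (weaken (B5 t ht z) (by linarith)) (hv2 t ht z)
        (weaken (B9 t ht z) (by linarith))
      rw [hXsq] at q1 q2
      dsimp only at q1 q2 ⊢
      linarith
    refine (scalarL2_le_of_bound (by positivity) hb).trans_eq ?_
    ring
  · intro t ht
    have hX0 : 0 ≤ C * exp (Γ * t) := by positivity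
    have hb : ∀ z, |advect (modeVelocity k γ χ t) (vorticity (modeVelocity k γ χ t)) z|
        ≤ 2 * C ^ 2 * exp (2 * Γ * t) := by
      intro z
      rw [vorticity_modeVelocity hχ]
      simp only [advect, smul_eq_mul]
      rw [partialX_modeFunction (smooth1 sζ), partialY_modeFunction (smooth1 sζ)]
      have q := quad hX0 (hv1 t ht z) (weaken (B7 t ht z) (by linarith)) (hv2 t ht z)
        (weaken (B6 t ht z) (by linarith))
      rw [hXsq] at q
      linarith
    refine (scalarL2_le_of_bound (by positivity) hb).trans_eq ?_
    ring

end

/-! ### Wirtinger's inequality and the Cauchy–Schwarz inequality on an interval -/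

lemma memLp_two_of_continuous {f : ℝ → ℂ} (hf : Continuous f) (a b : ℝ) :
    MemLp f 2 (volume.restrict (Ioc a b)) := by
  have h := (memLp_two_iff_integrable_sq_norm (μ := volume.restrict (Ioc a b)) (f := f)
    hf.aestronglyMeasurable).2
  refine h ?_
  have hc : Continuous fun x => ‖f x‖ ^ 2 := by fun_prop
  exact (hc.continuousOn.integrableOn_compact isCompact_Icc).mono_set Ioc_subset_Icc_self

/-- Wirtinger's inequality for periodic functions with mean zero. -/
lemma wirtinger_inequality {L : ℝ} (hL : 0 < L) {f f' : ℝ → ℂ} (hf : ∀ x, HasDerivAt f (f' x) x)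
    (hf' : Continuous f') (hper : f L = f 0) (hmean : ∫ x in (0 : ℝ)..L, f x = 0) :
    (2 * π / L) ^ 2 * ∫ x in (0 : ℝ)..L, ‖f x‖ ^ 2 ≤ ∫ x in (0 : ℝ)..L, ‖f' x‖ ^ 2 := by
  have hfc : Continuous f := continuous_iff_continuousAt.2 fun x => (hf x).continuousAt
  -- Parseval's identity reduces the claim to one Fourier coefficient at a time. The coefficient `n
  -- = 0` of `f` is its mean; for `n ≠ 0` integration by parts gives the factor `L / (2π |n|)`, and
  -- `|n| ≥ 1`.
  have s1 := (hasSum_sq_fourierCoeffOn hL (memLp_two_of_continuous hfc 0 L)).mul_left ((2 * π / L) ^ 2)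
  have s2 := hasSum_sq_fourierCoeffOn hL (memLp_two_of_continuous hf' 0 L)
  have hle := hasSum_le (fun n => ?_) s1 s2
  · rw [sub_zero, smul_eq_mul, smul_eq_mul] at hle
    have h1 := mul_le_mul_of_nonneg_left hle hL.le
    rw [mul_inv_cancel_left₀ hL.ne'] at h1
    refine le_trans (le_of_eq ?_) h1
    field_simp
  · rcases eq_or_ne n 0 with rfl | hn
    · have h0 : fourierCoeffOn hL f 0 = 0 := by
        rw [fourierCoeffOn_eq_integral]
        simp [hmean]
      rw [h0]
      simp
    · rw [fourierCoeffOn_of_hasDerivAt hL hn (fun x _ => hf x) (hf'.intervalIntegrable 0 L), hper]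
      have hn1 : (1 : ℝ) ≤ |(n : ℝ)| := by exact_mod_cast Int.one_le_abs hn
      have hn0 : (0 : ℝ) < |(n : ℝ)| := by linarith
      set z := fourierCoeffOn hL f' n
      have hnorm : ‖(1 / (-2 * π * Complex.I * n) * (fourier (-n) ((0 : ℝ) : AddCircle (L - 0)) * (f 0 - f 0)
          - ((L : ℝ) - (0 : ℝ) : ℂ) * z) : ℂ)‖ = L / (2 * π * |(n : ℝ)|) * ‖z‖ := by
        rw [sub_self, mul_zero, zero_sub, Complex.ofReal_zero, sub_zero, norm_mul, norm_neg, norm_mul,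
          norm_div, norm_mul, norm_mul, norm_mul, Complex.norm_real, Complex.norm_real, Complex.norm_I,
          Complex.norm_intCast, Real.norm_of_nonneg pi_pos.le, Real.norm_of_nonneg hL.le]
        simp
        ring
      rw [hnorm, mul_pow, ← mul_assoc, ← mul_pow]
      have h2 : 2 * π / L * (L / (2 * π * |(n : ℝ)|)) = 1 / |(n : ℝ)| := by
        field_simp
      rw [h2]
      have h3 : (1 / |(n : ℝ)|) ^ 2 ≤ 1 := by
        apply pow_le_one₀ (by positivity)
        rw [div_le_one hn0]
        exact hn1
      exact mul_le_of_le_one_left (sq_nonneg _) h3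

lemma sq_intervalIntegral_mul_le {L : ℝ} (hL : 0 ≤ L) {f g : ℝ → ℝ} (hf : Continuous f)
    (hg : Continuous g) :
    (∫ x in (0 : ℝ)..L, f x * g x) ^ 2
      ≤ (∫ x in (0 : ℝ)..L, f x ^ 2) * ∫ x in (0 : ℝ)..L, g x ^ 2 := by
  set A := ∫ x in (0 : ℝ)..L, f x ^ 2
  set B := ∫ x in (0 : ℝ)..L, f x * g x
  set C := ∫ x in (0 : ℝ)..L, g x ^ 2
  have key : ∀ s : ℝ, 0 ≤ A * (s * s) + 2 * B * s + C := by
    intro s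
    have h : ∫ x in (0 : ℝ)..L, (s * f x + g x) ^ 2 = A * (s * s) + 2 * B * s + C := by
      have e : ∀ x, (s * f x + g x) ^ 2 = s * s * f x ^ 2 + 2 * s * (f x * g x) + g x ^ 2 :=
        fun x => by ring
      simp only [e]
      rw [intervalIntegral.integral_add, intervalIntegral.integral_add,
        intervalIntegral.integral_const_mul, intervalIntegral.integral_const_mul]
      · ring
      all_goals exact Continuous.intervalIntegrable (by fun_prop) _ _
    rw [← h]
    exact intervalIntegral.integral_nonneg hL fun x _ => sq_nonneg _
  have hd := discrim_le_zero key
  rw [discrim] at hd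
  nlinarith

/-! ### The amplitude equation of a growing mode -/

section

variable {U₀ : ℝ} {m k : ℕ} {γ : ℝ} {χ ϖ : ℝ → ℂ}

/-- Evaluation at `x = 0` gives the real part of `A`, and a quarter wavelength later, at `x = π /
(2k)`, the imaginary part. -/
lemma eq_zero_of_modeFunction_eq_zero (hk : 1 ≤ k) {t : ℝ} {A : ℂ}
    (h : ∀ x : ℝ, (Complex.exp ((γ : ℂ) * t + Complex.I * k * x) * A).re = 0) : A = 0 := by
  have hk' : (k : ℂ) ≠ 0 := by exact_mod_cast (by omega : k ≠ 0)
  have he : ∀ x : ℝ, (Complex.exp (Complex.I * k * x) * A).re = 0 := by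
    intro x
    have h1 := h x
    rw [Complex.exp_add, mul_assoc, ← Complex.ofReal_mul, ← Complex.ofReal_exp,
      Complex.re_ofReal_mul] at h1
    exact (mul_eq_zero.1 h1).resolve_left (exp_pos _).ne'
  have h0 := he 0
  have h1 := he (π / (2 * k))
  have e1 : Complex.I * k * ((π / (2 * k) : ℝ) : ℂ) = (π / 2 : ℂ) * Complex.I := by
    push_cast
    field_simp
  rw [e1, Complex.exp_pi_div_two_mul_I] at h1
  simp at h0 h1
  exact Complex.ext h0 h1

/-- The two components of the linearized momentum equation at time `0`, with the common factor
`e^{ikx}` removed. The first expresses the pressure profile through `χ`, the second its derivative.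
-/
lemma amplitude_momentum (hk : 1 ≤ k) (hmode : IsGrowingMode U₀ m k γ χ ϖ) (y : ℝ) :
    Complex.I * k * ϖ y = γ * deriv χ y + Complex.I * k * (U₀ * sin (m * y) : ℝ) * deriv χ y
        - Complex.I * k * (U₀ * m * cos (m * y) : ℝ) * χ y ∧
      deriv ϖ y = -(γ * (Complex.I * k * χ y)) + k ^ 2 * (U₀ * sin (m * y) : ℝ) * χ y := by
  have c1 : ContDiff ℝ 1 (fun y => -deriv χ y) :=
    (contDiff_deriv_of_smooth hmode.smooth).neg.of_le (by norm_num)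
  have c2 : ContDiff ℝ 1 (fun y => Complex.I * k * χ y) :=
    (contDiff_const.mul hmode.smooth).of_le (by norm_num)
  have c3 : ContDiff ℝ 1 ϖ := hmode.pressure_smooth.of_le (by norm_num)
  have key : ∀ x : ℝ,
      modeFunction k γ (fun y => γ * -deriv χ y) 0 (x, y)
        = -(U₀ * sin (m * y) * modeFunction k γ (fun y => Complex.I * k * -deriv χ y) 0 (x, y))
          - modeFunction k γ (fun y => Complex.I * k * χ y) 0 (x, y) * (U₀ * m * cos (m * y))
          - modeFunction k γ (fun y => Complex.I * k * ϖ y) 0 (x, y) ∧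
      modeFunction k γ (fun y => γ * (Complex.I * k * χ y)) 0 (x, y)
        = -(U₀ * sin (m * y) * modeFunction k γ (fun y => Complex.I * k * (Complex.I * k * χ y)) 0 (x, y))
          - modeFunction k γ (deriv ϖ) 0 (x, y) := by
    intro x
    have h := hmode.linearized.momentum 0 (x, y)
    have d1 : HasDerivAt (fun s => modeVelocity k γ χ s (x, y))
        (modeFunction k γ (fun y => γ * -deriv χ y) 0 (x, y),
          modeFunction k γ (fun y => γ * (Complex.I * k * χ y)) 0 (x, y)) 0 := by
      simp only [fun s => modeVelocity_eq (k := k) (γ := γ) hmode.smooth s]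
      exact (hasDerivAt_modeFunction 0 (x, y)).prodMk (hasDerivAt_modeFunction 0 (x, y))
    have heq := d1.unique h
    rw [advect_field_eq (differentiableAt_modeVelocity hmode.smooth 0 (x, y)),
      advect_field_eq (differentiableAt_shearFlow (x, y)), modeVelocity_eq hmode.smooth] at heq
    simp only [shearFlow, partialX_shear, partialY_shear, partialX_zero, partialY_zero, grad,
      partialX_modeFunction c1, partialX_modeFunction c2, partialX_modeFunction c3,
      partialY_modeFunction c3] at heq
    have e1 := congrArg Prod.fst heq
    have e2 := congrArg Prod.snd heq
    simp only [Prod.fst_sub, Prod.snd_sub, Prod.fst_neg, Prod.snd_neg] at e1 e2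
    constructor
    · linear_combination e1
    · linear_combination e2
  have re : ∀ (r : ℝ) (E h : ℂ), r * (E * h).re = (E * (r * h)).re := fun r E h => by
    rw [mul_left_comm, Complex.re_ofReal_mul]
  constructor
  · rw [← sub_eq_zero]
    refine eq_zero_of_modeFunction_eq_zero (γ := γ) (t := 0) hk fun x => ?_
    have h := (key x).1
    simp only [modeFunction] at h
    rw [re, mul_comm (Complex.re _) (U₀ * m * cos (m * y)), re] at h
    set E := Complex.exp ((γ : ℂ) * ((0 : ℝ) : ℂ) + Complex.I * k * x)
    have h' : (E * (γ * -deriv χ y) + E * ((U₀ * sin (m * y) : ℝ) * (Complex.I * k * -deriv χ y))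
        + E * ((U₀ * m * cos (m * y) : ℝ) * (Complex.I * k * χ y)) + E * (Complex.I * k * ϖ y)).re = 0 := by
      simp only [Complex.add_re]
      linarith
    rw [← h']
    congr 1
    ring
  · rw [← sub_eq_zero]
    refine eq_zero_of_modeFunction_eq_zero (γ := γ) (t := 0) hk fun x => ?_
    have h := (key x).2
    simp only [modeFunction] at h
    rw [re] at h
    set E := Complex.exp ((γ : ℂ) * ((0 : ℝ) : ℂ) + Complex.I * k * x)
    have h' : (E * (γ * (Complex.I * k * χ y))
        + E * ((U₀ * sin (m * y) : ℝ) * (Complex.I * k * (Complex.I * k * χ y))) + E * deriv ϖ y).re = 0 := by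
      simp only [Complex.add_re]
      linarith
    rw [← h']
    congr 1
    linear_combination -E * k ^ 2 * (U₀ * sin (m * y) : ℝ) * χ y * Complex.I_sq

lemma hasDerivAt_shear_deriv (y : ℝ) :
    HasDerivAt (fun y => U₀ * m * cos (m * y)) (-(m ^ 2 * (U₀ * sin (m * y)))) y := by
  have h1 : HasDerivAt (fun y : ℝ => (m : ℝ) * y) m y := by
    simpa using (hasDerivAt_id y).const_mul (m : ℝ)
  exact (h1.cos.const_mul (U₀ * m)).congr_deriv (by ring)

/-- The Rayleigh equation of a growing mode. -/
lemma rayleigh_equation (hk : 1 ≤ k) (hmode : IsGrowingMode U₀ m k γ χ ϖ) (y : ℝ) :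
    γ * (deriv (deriv χ) y - k ^ 2 * χ y) + Complex.I * k * (U₀ * sin (m * y) : ℝ)
      * (deriv (deriv χ) y + (m ^ 2 - k ^ 2) * χ y) = 0 := by
  have d0 : HasDerivAt χ (deriv χ y) y := (hmode.smooth.differentiable (by norm_num) y).hasDerivAt
  have d1 : HasDerivAt (deriv χ) (deriv (deriv χ) y) y :=
    ((contDiff_deriv_of_smooth hmode.smooth).differentiable (by norm_num) y).hasDerivAt
  have dϖ : HasDerivAt ϖ (deriv ϖ y) y := (hmode.pressure_smooth.differentiable (by norm_num) y).hasDerivAt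
  have dU := (hasDerivAt_shear (U₀ := U₀) (m := m) y).ofReal_comp
  have dU' := (hasDerivAt_shear_deriv (U₀ := U₀) (m := m) y).ofReal_comp
  have hl : HasDerivAt (fun y => Complex.I * k * ϖ y) _ y := dϖ.const_mul (Complex.I * k)
  have hr := ((d1.const_mul (γ : ℂ)).add ((dU.const_mul (Complex.I * k)).mul d1)).sub
    ((dU'.const_mul (Complex.I * k)).mul d0)
  have hlr : (fun y => Complex.I * k * ϖ y) = fun y => γ * deriv χ y
      + Complex.I * k * (U₀ * sin (m * y) : ℝ) * deriv χ y
      - Complex.I * k * (U₀ * m * cos (m * y) : ℝ) * χ y :=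
    funext fun y => (amplitude_momentum hk hmode y).1
  rw [hlr] at hl
  -- The pressure is eliminated by differentiating the first amplitude equation and inserting the
  -- second.
  have h := hl.unique hr
  rw [(amplitude_momentum hk hmode y).2] at h
  push_cast at h ⊢
  linear_combination -h - γ * k ^ 2 * χ y * Complex.I_sq

end

/-! ### The upper bound for the growth rate -/

section

variable {U₀ : ℝ} {m k : ℕ} {γ : ℝ} {χ ϖ : ℝ → ℂ}

lemma intervalIntegral_eq_zero_of_periodic {E : Type*} [NormedAddCommGroup E] [NormedSpace ℝ E]
    [CompleteSpace E] {L : ℝ} {F F' : ℝ → E} (hF : ∀ x, HasDerivAt F (F' x) x)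
    (hF' : Continuous F') (hper : F L = F 0) : ∫ x in (0 : ℝ)..L, F' x = 0 := by
  rw [intervalIntegral.integral_eq_sub_of_hasDerivAt (fun x _ => hF x) (hF'.intervalIntegrable _ _),
    hper, sub_self]

/-- The equation is multiplied by the conjugate of `Z + (M - K) X`. The second term becomes `i s |Z
+ (M - K) X|²`, which is purely imaginary, so the real part of the first term vanishes. The shear
profile thereby disappears from the energy balance. -/
lemma re_mul_conj_eq_zero {g s K M : ℝ} {X Z : ℂ} (hg : g ≠ 0)
    (h : (g : ℂ) * (Z - (K : ℂ) * X) + Complex.I * (s : ℂ) * (Z + ((M : ℂ) - (K : ℂ)) * X) = 0) :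
    (Z.re - K * X.re) * (Z.re + (M - K) * X.re) + (Z.im - K * X.im) * (Z.im + (M - K) * X.im) = 0 := by
  have hre := congrArg Complex.re h
  have him := congrArg Complex.im h
  simp only [Complex.add_re, Complex.add_im, Complex.mul_re, Complex.mul_im, Complex.sub_re,
    Complex.sub_im, Complex.ofReal_re, Complex.ofReal_im, Complex.I_re, Complex.I_im,
    Complex.zero_re, Complex.zero_im] at hre him
  apply mul_left_cancel₀ hg
  linear_combination (Z.re + (M - K) * X.re) * hre + (Z.im + (M - K) * X.im) * him

/-- The balance of the energies of the amplitude, its derivative and its second derivative. -/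
lemma amplitude_energy (hk : 1 ≤ k) (hmode : IsGrowingMode U₀ m k γ χ ϖ) {L : ℝ}
    (hχ : Function.Periodic χ L) :
    (∫ x in (0 : ℝ)..L, ‖deriv (deriv χ) x‖ ^ 2) + 2 * k ^ 2 * (∫ x in (0 : ℝ)..L, ‖deriv χ x‖ ^ 2)
        + k ^ 4 * (∫ x in (0 : ℝ)..L, ‖χ x‖ ^ 2)
      = m ^ 2 * (∫ x in (0 : ℝ)..L, ‖deriv χ x‖ ^ 2)
        + m ^ 2 * k ^ 2 * (∫ x in (0 : ℝ)..L, ‖χ x‖ ^ 2) := by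
  have s1 := contDiff_deriv_of_smooth hmode.smooth
  have c0 := hmode.smooth.continuous
  have c1 := s1.continuous
  have c2 := (contDiff_deriv_of_smooth s1).continuous
  have d0 : ∀ y, HasDerivAt χ (deriv χ y) y := fun y =>
    (hmode.smooth.differentiable (by norm_num) y).hasDerivAt
  have d1 : ∀ y, HasDerivAt (deriv χ) (deriv (deriv χ) y) y := fun y =>
    (s1.differentiable (by norm_num) y).hasDerivAt
  -- `J` is the derivative of the real inner product of `χ` and `χ'`, so its integral over a period
  -- vanishes.
  set J : ℝ → ℝ := fun y => inner ℝ (χ y) (deriv (deriv χ) y) + inner ℝ (deriv χ y) (deriv χ y) with hJ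
  have hJ0 : ∫ x in (0 : ℝ)..L, J x = 0 := by
    refine intervalIntegral_eq_zero_of_periodic (F := fun y => inner ℝ (χ y) (deriv χ y))
      (fun y => (d0 y).inner ℝ (d1 y)) (by fun_prop) ?_
    simp only [hχ.eq, (periodic_deriv hχ).eq]
  have hpt : ∀ y, ‖deriv (deriv χ) y‖ ^ 2 + 2 * k ^ 2 * ‖deriv χ y‖ ^ 2 + k ^ 4 * ‖χ y‖ ^ 2
      = (2 * k ^ 2 - m ^ 2) * J y
        + (m ^ 2 * ‖deriv χ y‖ ^ 2 + m ^ 2 * k ^ 2 * ‖χ y‖ ^ 2) := by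
    intro y
    have h := rayleigh_equation hk hmode y
    have hi : J y = (χ y).re * (deriv (deriv χ) y).re + (χ y).im * (deriv (deriv χ) y).im
        + ‖deriv χ y‖ ^ 2 := by
      rw [hJ]
      simp only [real_inner_self_eq_norm_sq]
      rw [Complex.inner]
      simp
      ring
    rw [hi]
    simp only [Complex.sq_norm, Complex.normSq_apply]
    have h' := re_mul_conj_eq_zero (g := γ) (s := k * (U₀ * sin (m * y))) (K := k ^ 2) (M := m ^ 2)
      (X := χ y) (Z := deriv (deriv χ) y) hmode.rate_pos.ne' (by
        rw [← h]
        push_cast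
        ring)
    linear_combination h'
  have hint := congrArg (fun f : ℝ → ℝ => ∫ x in (0 : ℝ)..L, f x) (funext hpt)
  have cJ : Continuous J := by fun_prop
  rw [intervalIntegral.integral_add, intervalIntegral.integral_add, intervalIntegral.integral_add,
    intervalIntegral.integral_add, intervalIntegral.integral_const_mul,
    intervalIntegral.integral_const_mul, intervalIntegral.integral_const_mul,
    intervalIntegral.integral_const_mul, intervalIntegral.integral_const_mul, hJ0, mul_zero,
    zero_add] at hint
  · exact hint
  all_goals exact Continuous.intervalIntegrable (by fun_prop) _ _

/-- Pythagoras: the constant functions are orthogonal to those of mean zero. -/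
lemma integral_norm_sub_mean_sq {L : ℝ} (hL : 0 < L) {f : ℝ → ℂ} (hf : Continuous f) :
    ∫ x in (0 : ℝ)..L, ‖f x - (L : ℂ)⁻¹ * ∫ y in (0 : ℝ)..L, f y‖ ^ 2
      = (∫ x in (0 : ℝ)..L, ‖f x‖ ^ 2) - L * ‖(L : ℂ)⁻¹ * ∫ y in (0 : ℝ)..L, f y‖ ^ 2 := by
  set c := (L : ℂ)⁻¹ * ∫ y in (0 : ℝ)..L, f y with hc
  have hint : ∫ y in (0 : ℝ)..L, f y = L * c := by
    rw [hc, mul_inv_cancel_left₀ (Complex.ofReal_ne_zero.2 hL.ne')]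
  have hpt : ∀ x, ‖f x - c‖ ^ 2 = ‖f x‖ ^ 2 - 2 * (c.re * (f x).re + c.im * (f x).im) + ‖c‖ ^ 2 := by
    intro x
    simp only [Complex.sq_norm, Complex.normSq_apply, Complex.sub_re, Complex.sub_im]
    ring
  have hre : ∫ x in (0 : ℝ)..L, (f x).re = L * c.re := by
    have h := Complex.reCLM.intervalIntegral_comp_comm (hf.intervalIntegrable (μ := volume) 0 L)
    rw [hint] at h
    simpa using h
  have him : ∫ x in (0 : ℝ)..L, (f x).im = L * c.im := by
    have h := Complex.imCLM.intervalIntegral_comp_comm (hf.intervalIntegrable (μ := volume) 0 L)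
    rw [hint] at h
    simpa using h
  simp only [hpt]
  have i1 : Continuous fun x => (f x).re := Complex.continuous_re.comp hf
  have i2 : Continuous fun x => (f x).im := Complex.continuous_im.comp hf
  rw [intervalIntegral.integral_add, intervalIntegral.integral_sub,
    intervalIntegral.integral_const_mul, intervalIntegral.integral_add,
    intervalIntegral.integral_const_mul, intervalIntegral.integral_const_mul, hre, him,
    intervalIntegral.integral_const, smul_eq_mul]
  · simp only [Complex.sq_norm, Complex.normSq_apply]
    ring
  all_goals exact Continuous.intervalIntegrable (by fun_prop) _ _

/-- The mean of the Rayleigh equation, estimated by the Cauchy–Schwarz inequality. -/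
lemma rate_sq_mul_mean_le (hk : 1 ≤ k) (hm : 0 < m) (hmode : IsGrowingMode U₀ m k γ χ ϖ)
    (hχ : Function.Periodic χ (2 * π / m)) {c : ℂ}
    (hc : ∫ x in (0 : ℝ)..(2 * π / m), χ x = ((2 * π / m : ℝ) : ℂ) * c) :
    γ ^ 2 * ((2 * π / m) * ‖c‖ ^ 2)
      ≤ k ^ 2 * U₀ ^ 2 / 2 * ∫ x in (0 : ℝ)..(2 * π / m), ‖χ x - c‖ ^ 2 := by
  have hm' : (0 : ℝ) < m := by exact_mod_cast hm
  have hmL : (m : ℝ) * (2 * π / m) = 2 * π := by field_simp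
  set L : ℝ := 2 * π / m with hLdef
  have hL : 0 < L := by positivity
  have hk' : (k : ℂ) ≠ 0 := by exact_mod_cast (by omega : k ≠ 0)
  have s1 := contDiff_deriv_of_smooth hmode.smooth
  have c0 := hmode.smooth.continuous
  have c1 := s1.continuous
  have c2 := (contDiff_deriv_of_smooth s1).continuous
  have d0 : ∀ y, HasDerivAt χ (deriv χ y) y := fun y =>
    (hmode.smooth.differentiable (by norm_num) y).hasDerivAt
  have d1 : ∀ y, HasDerivAt (deriv χ) (deriv (deriv χ) y) y := fun y =>
    (s1.differentiable (by norm_num) y).hasDerivAt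
  set U : ℝ → ℝ := fun y => U₀ * sin (m * y) with hU
  have cU : Continuous U := by fun_prop
  have dU := fun y => (hasDerivAt_shear (U₀ := U₀) (m := m) y).ofReal_comp
  have dU' := fun y => (hasDerivAt_shear_deriv (U₀ := U₀) (m := m) y).ofReal_comp
  have hU_mean : ∫ y in (0 : ℝ)..L, U y = 0 := by
    refine intervalIntegral_eq_zero_of_periodic (F := fun y => -(U₀ * m * cos (m * y)) / m ^ 2)
      (fun y => ((hasDerivAt_shear_deriv y).neg.div_const _).congr_deriv ?_) cU ?_
    · rw [neg_neg]
      field_simp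
      rw [hU]
    · simp only [hmL, mul_zero, Real.cos_two_pi, Real.cos_zero]
  have hU_sq : ∫ y in (0 : ℝ)..L, |U y| ^ 2 = U₀ ^ 2 * (L / 2) := by
    have hd : ∀ y : ℝ, HasDerivAt (fun y => U₀ ^ 2 * (y / 2) - U₀ * sin (m * y) * (U₀ * m * cos (m * y)) / (2 * m ^ 2))
        (|U y| ^ 2) y := by
      intro y
      have h1 := (((hasDerivAt_id y).div_const 2).const_mul (U₀ ^ 2)).sub
        (((hasDerivAt_shear (U₀ := U₀) (m := m) y).mul
          (hasDerivAt_shear_deriv (U₀ := U₀) (m := m) y)).div_const (2 * m ^ 2))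
      refine h1.congr_deriv ?_
      rw [sq_abs, hU]
      field_simp
      have h2 := Real.sin_sq_add_cos_sq (m * y)
      linear_combination -U₀ ^ 2 * h2
    rw [intervalIntegral.integral_eq_sub_of_hasDerivAt (fun y _ => hd y)
      (Continuous.intervalIntegrable (by fun_prop) _ _)]
    simp [hmL]
  -- Because `U'' = -m² U`, the integrand is the derivative of the periodic function `U χ' - U' χ`.
  have hUχ : ∫ y in (0 : ℝ)..L, (U y : ℂ) * (deriv (deriv χ) y + m ^ 2 * χ y) = 0 := by
    refine intervalIntegral_eq_zero_of_periodic
      (F := fun y => ((U₀ * sin (m * y) : ℝ) : ℂ) * deriv χ y - ((U₀ * m * cos (m * y) : ℝ) : ℂ) * χ y)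
      (fun y => (((dU y).mul (d1 y)).sub ((dU' y).mul (d0 y))).congr_deriv ?_) (by fun_prop) ?_
    · rw [hU]
      push_cast
      ring
    · simp only [hχ.eq, (periodic_deriv hχ).eq, hmL, mul_zero, Real.sin_two_pi, Real.cos_two_pi,
        Real.sin_zero, Real.cos_zero]
  have hχ2 : ∫ y in (0 : ℝ)..L, deriv (deriv χ) y = 0 :=
    intervalIntegral_eq_zero_of_periodic d1 c2 (periodic_deriv hχ).eq
  -- Integrating the Rayleigh equation over a period leaves only the mean of `χ` and the integral of
  -- `U χ`; the common factor `k²` is divided out.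
  have hmean : (γ : ℂ) * (L * c) = -(Complex.I * k * ∫ y in (0 : ℝ)..L, (U y : ℂ) * χ y) := by
    have hpt : ∀ y, 0 = γ * deriv (deriv χ) y - γ * k ^ 2 * χ y
        + Complex.I * k * ((U y : ℂ) * (deriv (deriv χ) y + m ^ 2 * χ y))
        - Complex.I * k ^ 3 * ((U y : ℂ) * χ y) := by
      intro y
      rw [← rayleigh_equation hk hmode y, hU]
      ring
    have hint : (∫ _ in (0 : ℝ)..L, (0 : ℂ)) = _ := intervalIntegral.integral_congr fun y _ => hpt y
    rw [intervalIntegral.integral_zero, intervalIntegral.integral_sub, intervalIntegral.integral_add,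
      intervalIntegral.integral_sub, intervalIntegral.integral_const_mul,
      intervalIntegral.integral_const_mul, intervalIntegral.integral_const_mul,
      intervalIntegral.integral_const_mul, hUχ, hχ2, hc] at hint
    · apply mul_left_cancel₀ (pow_ne_zero 2 hk')
      linear_combination hint
    all_goals exact Continuous.intervalIntegrable (by fun_prop) _ _
  -- As `U` has mean zero, `χ` may be replaced by its oscillating part. Only this makes the
  -- Cauchy–Schwarz bound sharp enough.
  have hUh : ∫ y in (0 : ℝ)..L, (U y : ℂ) * χ y = ∫ y in (0 : ℝ)..L, (U y : ℂ) * (χ y - c) := by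
    simp only [mul_sub]
    rw [intervalIntegral.integral_sub, intervalIntegral.integral_mul_const,
      intervalIntegral.integral_ofReal, hU_mean, Complex.ofReal_zero, zero_mul, sub_zero]
    all_goals exact Continuous.intervalIntegrable (by fun_prop) _ _
  rw [hUh] at hmean
  have hnorm := congrArg norm hmean
  rw [norm_neg, norm_mul, norm_mul, norm_mul, norm_mul, Complex.norm_I, Complex.norm_real,
    Complex.norm_real, Complex.norm_natCast, Real.norm_of_nonneg hL.le,
    Real.norm_of_nonneg hmode.rate_pos.le, one_mul] at hnorm
  have hle : ‖∫ y in (0 : ℝ)..L, (U y : ℂ) * (χ y - c)‖ ≤ ∫ y in (0 : ℝ)..L, |U y| * ‖χ y - c‖ := by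
    refine (intervalIntegral.norm_integral_le_integral_norm hL.le).trans_eq ?_
    simp only [norm_mul, Complex.norm_real, Real.norm_eq_abs]
  have hcs := sq_intervalIntegral_mul_le hL.le (f := fun y => |U y|) (g := fun y => ‖χ y - c‖)
    (by fun_prop) (by fun_prop)
  rw [hU_sq] at hcs
  have h1 := (pow_le_pow_left₀ (norm_nonneg _) hle 2).trans hcs
  have h2 : (γ * (L * ‖c‖)) ^ 2 ≤ k ^ 2 * (U₀ ^ 2 * (L / 2) * ∫ x in (0 : ℝ)..L, ‖χ x - c‖ ^ 2) := by
    rw [hnorm, mul_pow]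
    exact mul_le_mul_of_nonneg_left h1 (by positivity)
  refine le_of_mul_le_mul_left ?_ hL
  linarith

/-- A growing mode of the period of the shear flow grows at most at the rate `γ_u`. -/
theorem growth_rate_le (hU₀ : 0 < U₀) (hk : 1 ≤ k) (hkm : k < m)
    (hmode : IsGrowingMode U₀ m k γ χ ϖ) (hχ : Function.Periodic χ (2 * π / m)) :
    γ ≤ gammaU U₀ m k ∨ ∀ y, χ y = 0 := by
  have hk' : (0 : ℝ) < k := by exact_mod_cast hk
  have hkm' : (k : ℝ) < m := by exact_mod_cast hkm
  have hm' : (0 : ℝ) < m := hk'.trans hkm'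
  have hMK : (0 : ℝ) < (m : ℝ) ^ 2 - (k : ℝ) ^ 2 := by nlinarith
  have hper := periodic_deriv hχ
  have hE := amplitude_energy hk hmode hχ
  have hR := @rate_sq_mul_mean_le U₀ m k γ χ ϖ hk (by omega) hmode hχ
  have hω : 2 * π / (2 * π / m) = (m : ℝ) := by field_simp
  set L : ℝ := 2 * π / m with hLdef
  have hL : 0 < L := by positivity
  have s1 := contDiff_deriv_of_smooth hmode.smooth
  have c0 := hmode.smooth.continuous
  have c1 := s1.continuous
  have c2 := (contDiff_deriv_of_smooth s1).continuous
  have d0 : ∀ y, HasDerivAt χ (deriv χ y) y := fun y =>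
    (hmode.smooth.differentiable (by norm_num) y).hasDerivAt
  have d1 : ∀ y, HasDerivAt (deriv χ) (deriv (deriv χ) y) y := fun y =>
    (s1.differentiable (by norm_num) y).hasDerivAt
  have hH := integral_norm_sub_mean_sq hL c0
  set c : ℂ := (L : ℂ)⁻¹ * ∫ y in (0 : ℝ)..L, χ y with hcdef
  have hc : ∫ x in (0 : ℝ)..L, χ x = (L : ℂ) * c := by
    rw [hcdef, mul_inv_cancel_left₀ (Complex.ofReal_ne_zero.2 hL.ne')]
  have hRc := hR hc
  have w1 := wirtinger_inequality hL (f := fun y => χ y - c) (f' := deriv χ)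
    (fun y => (d0 y).sub_const c) c1 (by simp only [hχ.eq]) (by
      rw [intervalIntegral.integral_sub (c0.intervalIntegrable _ _) (by simp), hc,
        intervalIntegral.integral_const]
      simp)
  have w2 := wirtinger_inequality hL d1 c2 hper.eq
    (intervalIntegral_eq_zero_of_periodic d0 c1 hχ.eq)
  rw [hω] at w1 w2
  set P₀ := ∫ x in (0 : ℝ)..L, ‖χ x‖ ^ 2
  set P₁ := ∫ x in (0 : ℝ)..L, ‖deriv χ x‖ ^ 2
  set P₂ := ∫ x in (0 : ℝ)..L, ‖deriv (deriv χ) x‖ ^ 2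
  set H := ∫ x in (0 : ℝ)..L, ‖χ x - c‖ ^ 2
  have hk2 : (0 : ℝ) < (k : ℝ) ^ 2 := by positivity
  -- The energy balance with `m² P₁ ≤ P₂` inserted: the terms `m² P₁` cancel and `k²` divides out.
  have e1 : 2 * P₁ ≤ ((m : ℝ) ^ 2 - k ^ 2) * P₀ := by
    refine le_of_mul_le_mul_left ?_ hk2
    linarith
  -- From `m² H ≤ P₁` and `P₀ = H + L |c|²`: the oscillating part is controlled by the mean.
  have e2 : ((m : ℝ) ^ 2 + k ^ 2) * H ≤ (m ^ 2 - k ^ 2) * (L * ‖c‖ ^ 2) := by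
    have h : P₀ = H + L * ‖c‖ ^ 2 := by linarith
    rw [h] at e1
    linarith
  have hsum : (0 : ℝ) < (m : ℝ) ^ 2 + (k : ℝ) ^ 2 := by positivity
  -- With mean zero, `e2` forces `H = 0`, so the profile vanishes. Otherwise `e2` is inserted into
  -- the mean estimate and `L |c|²` is divided out.
  by_cases hc0 : c = 0
  · right
    have hP : P₀ ≤ 0 := by
      rw [hc0, norm_zero] at e2 hH
      have : H ≤ 0 := nonpos_of_mul_nonpos_right (by simpa using e2) hsum
      linarith
    have hzero : ∀ y ∈ Icc 0 L, χ y = 0 := by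
      have hP0 : P₀ = 0 := le_antisymm hP
        (intervalIntegral.integral_nonneg hL.le fun x _ => sq_nonneg _)
      by_contra! hne
      obtain ⟨y, hy, hy0⟩ := hne
      have hpos : 0 < P₀ := intervalIntegral.integral_pos hL (by fun_prop)
        (fun x _ => sq_nonneg _) ⟨y, hy, by positivity⟩
      linarith
    intro y
    obtain ⟨x, hx, hxy⟩ := hχ.exists_mem_Ico₀ hL y
    rw [hxy]
    exact hzero x (Ico_subset_Icc_self hx)
  · left
    have hpos : 0 < L * ‖c‖ ^ 2 := by positivity
    have e3 : γ ^ 2 * (L * ‖c‖ ^ 2)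
        ≤ k ^ 2 * U₀ ^ 2 / 2 * ((m ^ 2 - k ^ 2) / (m ^ 2 + k ^ 2)) * (L * ‖c‖ ^ 2) := by
      refine hRc.trans ?_
      rw [mul_assoc (_ / 2)]
      refine mul_le_mul_of_nonneg_left ?_ (by positivity)
      rw [div_mul_eq_mul_div, le_div_iff₀ hsum]
      linarith
    have e4 := le_of_mul_le_mul_right e3 hpos
    refine le_of_sq_le_sq ?_ (gammaU_pos hU₀ hk hkm).le
    refine e4.trans_eq ?_
    rw [gammaU, mul_pow, Real.sq_sqrt (by positivity)]
    ring

end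

end EulerTorus

theorem mainTheorem6 (U₀ : ℝ) (hU₀ : 0 < U₀) (m k : ℕ) (hk : 1 ≤ k) (hkm : k < m)
    (γ : ℝ) (χ ϖ : ℝ → ℂ) (hmode : EulerTorus.IsGrowingMode U₀ m k γ χ ϖ)
    (hclass : Function.Periodic χ (2 * Real.pi / m) ∨ γ ≤ EulerTorus.gammaU U₀ m k) :
    (∃ α β b₁ b₂ : ℝ, EulerTorus.AdmissibleConstants U₀ m k γ χ α β b₁ b₂) ∧
    ∀ α β b₁ b₂ κ : ℝ, EulerTorus.AdmissibleConstants U₀ m k γ χ α β b₁ b₂ →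
      κ = 1 / (α * β - 2 * EulerTorus.gammaU U₀ m k) * (b₁ + α * b₂ / (2 * β)) →
      ∀ ε : ℝ, 0 < ε → ε < 1 →
      ∀ (T : ℝ) (u : ℝ → EulerTorus.VField) (P : ℝ → ℝ × ℝ → ℝ),
        EulerTorus.IsEulerSolution T u P →
        u 0 = EulerTorus.linearizedFlow U₀ m k γ χ ε 0 →
        ∀ t : ℝ, 0 ≤ t → t ≤ T → t ≤ (EulerTorus.gammaU U₀ m k)⁻¹ * Real.log (1 / ε) →
          EulerTorus.fieldL2 (fun z => u t z - EulerTorus.linearizedFlow U₀ m k γ χ ε t z)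
            ≤ ε ^ 2 * κ * (Real.exp (α * β * t) - 1) := by
  have hΓ := EulerTorus.gammaU_pos hU₀ hk hkm
  refine ⟨?_, ?_⟩
  · refine EulerTorus.exists_admissibleConstants hU₀ hΓ hmode.smooth hmode.periodic ?_
    rcases hclass with h | h
    · exact EulerTorus.growth_rate_le hU₀ hk hkm hmode h
    · exact Or.inl h
  · intro α β b₁ b₂ κ hadm hκ ε hε hε1 T u P hu h0 t ht htT hte
    -- The time `0` is treated apart, since the comparison theorem needs a slab of positive length;
    -- there the error is zero.
    rcases ht.eq_or_lt with rfl | ht'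
    · rw [h0]
      simp [EulerTorus.fieldL2, EulerTorus.scalarL2, EulerTorus.vecLength]
    · rw [hκ]
      exact EulerTorus.fieldL2_sub_linearizedFlow_le hΓ.le hmode hadm hε hε1 hu h0 ht' htT hte
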